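/- Consider the firefighter process on a graph $G$ with a vertex $s$. At time $0$ the fire breaks out at $s$. At each step $t\ge 1$ first the firefighter may protect one vertex that is not on fire (which stays protected forever), and then the fire spreads from the burning vertices to all their unprotected neighbours; burning vertices keep burning. A vertex is saved if it never burns. Maximum $k$-Vertex Protection asks, given $G$, $s$ and $k\ge 0$, for a strategy that protects at most $k$ vertices and saves as many vertices as possible among all such strategies. Theorem. Maximum $k$-Vertex Protection on trees can be solved in time $O(2^k k n)$, where $n$ is the number of vertices. Precisely: there are one program $P$ for a random access machine (unit-cost instructions: constants, copying, $+$, truncated $-$, $\times$, integer division, indirect load and store, jumps and conditional jumps) and one constant $C$ such that for every tree $G$ on the vertices $0,\dots,n-1$, every vertex $s$, every integer $k\ge 0$, and every adjacency-list representation of $G$, the program $P$, started on $n$, $s$, $k$ and these adjacency lists, halts after at most $C\cdot 2^k\cdot\max\{k,1\}\cdot n$ steps, and its output is a list $p_1,\dots,p_m$ of vertices with $m\le k$ such that protecting $p_t$ at step $t$ for $t=1,\dots,m$ is an optimal strategy, together with the number of vertices that it saves. Moreover, all numbers held by the machine during the computation are at most $(2^k (n+1))^C$, that is, words of $O(k+\log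 n)$ bits suffice. -/

import Mathlib

/-! ### The firefighter process on a graph -/

namespace Firefighter

/-- What the firefighter does: `σ t` is the vertex that is protected at step `t + 1`
(so `σ 0` is protected at step `1`), or `none` if no vertex is protected at that step. -/
abbrev Strategy (V : Type*) := ℕ → Option V

/-- The set of vertices that have been protected during the steps `1, …, t`. -/
def guarded {V : Type*} (σ : Strategy V) (t : ℕ) : Set V :=
  {v | ∃ i < t, σ i = some v}

/-- The set of vertices that are on fire at time `t`.  The fire breaks out at `s` at time `0`.
At step `t + 1` the vertex `σ t` is protected first, and then the fire spreads to all
neighbours of burning vertices that have not been protected. -/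
def burning {V : Type*} (G : SimpleGraph V) (s : V) (σ : Strategy V) : ℕ → Set V
  | 0 => {s}
  | t + 1 => burning G s σ t ∪
      {v | v ∉ guarded σ (t + 1) ∧ ∃ u ∈ burning G s σ t, G.Adj u v}

/-- Only vertices that are not yet on fire may be protected. -/
def IsValid {V : Type*} (G : SimpleGraph V) (s : V) (σ : Strategy V) : Prop :=
  ∀ (t : ℕ) (v : V), σ t = some v → v ∉ burning G s σ t

/-- The set of vertices that never burn. -/
def saved {V : Type*} (G : SimpleGraph V) (s : V) (σ : Strategy V) : Set V :=
  {v | ∀ t, v ∉ burning G s σ t}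

/-- `σ` is a strategy for the fire starting at `s` that protects at most `k` vertices. -/
def IsFeasible {V : Type*} (G : SimpleGraph V) (s : V) (k : ℕ) (σ : Strategy V) : Prop :=
  IsValid G s σ ∧ {t | σ t ≠ none}.encard ≤ k

/-- `σ` is a solution of the instance `(G, s, k)` of Maximum `k`-Vertex Protection. -/
def IsOptimal {V : Type*} (G : SimpleGraph V) (s : V) (k : ℕ) (σ : Strategy V) : Prop :=
  IsFeasible G s k σ ∧
    ∀ τ : Strategy V, IsFeasible G s k τ → (saved G s τ).ncard ≤ (saved G s σ).ncard

end Firefighter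

/-! ### Random access machines

A machine has registers, which the program addresses directly, and a memory, which is
addressed through registers.  All cells hold natural numbers.  The size of these numbers is
not limited by the semantics; it is limited by the predicate `RAM.WordsAtMost`. -/

namespace RAM

/-- The instructions.  Arguments `r`, `a`, `b` are names of registers, `c` is a constant and
`l` is a position in the program. -/
inductive Instr : Type
  /-- `r := c` -/
  | const (r c : ℕ)
  /-- `r := a` -/
  | copy (r a : ℕ)
  /-- `r := a + b` -/
  | add (r a b : ℕ)
  /-- `r := max (a - b) 0` -/
  | sub (r a b : ℕ)
  /-- `r := a * b` -/
  | mul (r a b : ℕ)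
  /-- `r := ⌊a / b⌋` (and `0` if `b = 0`) -/
  | div (r a b : ℕ)
  /-- `r := mem[a]` -/
  | load (r a : ℕ)
  /-- `mem[a] := b` -/
  | store (a b : ℕ)
  /-- go to position `l` -/
  | jump (l : ℕ)
  /-- go to position `l` if `a < b` -/
  | jumpLt (a b l : ℕ)
  /-- go to position `l` if `a = b` -/
  | jumpEq (a b l : ℕ)

/-- A program is a finite list of instructions. -/
abbrev Program := List Instr

/-- A configuration: program counter, registers, memory. -/
structure Config : Type where
  pc : ℕ
  reg : ℕ → ℕ
  mem : ℕ → ℕ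

/-- `x` with the register `r` set to `v`, at the next position of the program. -/
def Config.setReg (x : Config) (r v : ℕ) : Config :=
  { x with pc := x.pc + 1, reg := Function.update x.reg r v }

/-- The effect of one instruction. -/
def Instr.exec (x : Config) : Instr → Config
  | const r c => x.setReg r c
  | copy r a => x.setReg r (x.reg a)
  | add r a b => x.setReg r (x.reg a + x.reg b)
  | sub r a b => x.setReg r (x.reg a - x.reg b)
  | mul r a b => x.setReg r (x.reg a * x.reg b)
  | div r a b => x.setReg r (x.reg a / x.reg b)
  | load r a => x.setReg r (x.mem (x.reg a))
  | store a b => { x with pc := x.pc + 1, mem := Function.update x.mem (x.reg a) (x.reg b) }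
  | jump l => { x with pc := l }
  | jumpLt a b l => { x with pc := if x.reg a < x.reg b then l else x.pc + 1 }
  | jumpEq a b l => { x with pc := if x.reg a = x.reg b then l else x.pc + 1 }

/-- One step.  A machine whose program counter has left the program has halted and does not
change any more. -/
def step (P : Program) (x : Config) : Config :=
  match P[x.pc]? with
  | none => x
  | some i => i.exec x

/-- The configuration after `t` steps; every instruction takes one step. -/
def run (P : Program) (x : Config) (t : ℕ) : Config := (step P)^[t] x

/-- The program counter has left the program. -/
def Halted (P : Program) (x : Config) : Prop := P.length ≤ x.pc

/-- All numbers held in registers and memory are at most `B`. -/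
def WordsAtMost (B : ℕ) (x : Config) : Prop := (∀ r, x.reg r ≤ B) ∧ ∀ a, x.mem a ≤ B

end RAM

/-! ### Input and output of algorithms for Maximum `k`-Vertex Protection -/

namespace Firefighter

/-- `adj v` lists the neighbours of `v`, each once, in some order. -/
def IsAdjacencyList {n : ℕ} (G : SimpleGraph (Fin n)) (adj : Fin n → List (Fin n)) : Prop :=
  ∀ v, (adj v).Nodup ∧ ∀ u, u ∈ adj v ↔ G.Adj v u

/-- The adjacency lists as an array: cell `v ≤ n` holds the address at which the
neighbours of the vertex `v` start (and those of `v - 1` end); the lists of neighbours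
follow from cell `n + 1` on. -/
def inputArray {n : ℕ} (adj : Fin n → List (Fin n)) : List ℕ :=
  (List.range (n + 1)).map (fun v => n + 1 + ((List.ofFn adj).take v).flatten.length) ++
    (List.ofFn adj).flatten.map Fin.val

/-- The initial configuration: `n`, `s`, `k` are in the registers `0`, `1`, `2`, the adjacency
lists are at the beginning of the memory, and all other cells are `0`. -/
def inputConfig {n : ℕ} (adj : Fin n → List (Fin n)) (s : Fin n) (k : ℕ) : RAM.Config where
  pc := 0
  reg := fun r => if r = 0 then n else if r = 1 then (s : ℕ) else if r = 2 then k else 0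
  mem := fun a => (inputArray adj).getD a 0

/-- The configuration presents the list `p` of vertices and the number `m`: register `0` holds
the length of `p`, register `1` the address at which `p` is stored, and register `2` holds `m`. -/
def IsOutput {n : ℕ} (x : RAM.Config) (p : List (Fin n)) (m : ℕ) : Prop :=
  x.reg 0 = p.length ∧ (∀ (i : ℕ) (hi : i < p.length), x.mem (x.reg 1 + i) = (p[i] : ℕ)) ∧
    x.reg 2 = m

/-- The strategy that protects the vertices of the list `p` one after another, starting at
step `1`, and nothing afterwards. -/
def Strategy.ofList {V : Type*} (p : List V) : Strategy V := fun t => p[t]?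

end Firefighter

/-!
On a tree with root `s` the fire reaches a vertex `u` exactly at the time that equals the depth of
`u`, unless an ancestor of `u` (or `u` itself) has been protected before the fire gets there
(`IsRooting.exists_guard_of_not_burning`, `IsRooting.mem_saved_of_guard`).  So a strategy saves the
union of the subtrees of the vertices that it protects in time.  The vertex that is protected as
the `j`-th one, if it is of use, has depth at least `j`, and may be replaced by its ancestor of
depth `j`; hence it is enough to choose at most one vertex of each of the depths `1, …, k`
(`IsRooting.exists_selection`), and conversely vertices of the depths `1, 2, …, m` with `m ≤ k` form
a feasible strategy (`IsRooting.isFeasible_ofList`).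

The best choice is found by a dynamic program over the vertices in the order of a depth-first
search.  In this order the subtree of the `i`-th vertex `v` occupies the places from `i` to
`i + size v - 1` (`IsRooting.dfsStack_eq`).  Let `F i S` be the largest number of vertices that can be
saved by vertices from the place `i` on whose depths are different elements of the set `S`.  Then
`F i S` is the maximum of `F (i + 1) S` and, if the depth of `v` belongs to `S`,
of `size v + F (i + size v) (S \ {depth of v})`; this is `IsTable`.  That such a table bounds all
strategies from above is `IsTable.ncard_saved_le`; that the traceback through the table yields a
strategy that attains the bound is `IsTraced.isOptimal`.  The depths that the traceback leaves out
are filled up with arbitrary vertices of the right depth.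

The sets `S` are the numbers below `2 ^ (k + 1)`, read in binary, so the table has
`O(2 ^ k * n)` entries, and each of them takes a constant number of instructions.  The search, the
sizes of the subtrees and the traceback take `O(n)` steps.  The machine program is written in a
small structured language (`RAM.Cmd`) with a compiler and with rules that bound the running time
and the words together with the proof of correctness (`RAM.Does`); `does_main` puts the parts
together.
-/

/-! ### Structured programs for the random access machine -/

namespace RAM

/-- Structured programs.  `op` is meant for instructions that are not jumps. -/
inductive Cmd : Type
  /-- a single instruction -/
  | op (i : Instr)
  /-- `c`, then `d` -/
  | seq (c d : Cmd)
  /-- if `a = b` then `c` else `d` -/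
  | ifEq (a b : ℕ) (c d : Cmd)
  /-- if `a < b` then `c` else `d` -/
  | ifLt (a b : ℕ) (c d : Cmd)
  /-- while `a < b` do `c` -/
  | whileLt (a b : ℕ) (c : Cmd)

infixr:60 " ;; " => Cmd.seq

namespace Cmd

/-- The number of instructions of the compiled program. -/
def len : Cmd → ℕ
  | op _ => 1
  | seq c d => c.len + d.len
  | ifEq _ _ c d => d.len + c.len + 2
  | ifLt _ _ c d => d.len + c.len + 2
  | whileLt _ _ c => c.len + 2

/-- The machine code of a structured program, to be placed at position `l`.  A loop starts
with a jump to its test, which stands behind the body. -/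
def compile : Cmd → ℕ → Program
  | op i, _ => [i]
  | seq c d, l => c.compile l ++ d.compile (l + c.len)
  | ifEq a b c d, l => .jumpEq a b (l + d.len + 2) :: (d.compile (l + 1) ++
      .jump (l + d.len + c.len + 2) :: c.compile (l + d.len + 2))
  | ifLt a b c d, l => .jumpLt a b (l + d.len + 2) :: (d.compile (l + 1) ++
      .jump (l + d.len + c.len + 2) :: c.compile (l + d.len + 2))
  | whileLt a b c, l => .jump (l + c.len + 1) :: (c.compile (l + 1) ++ [.jumpLt a b (l + 1)])

theorem length_compile (c : Cmd) : ∀ l, (c.compile l).length = c.len := by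
  induction c <;> intro l <;> simp_all [compile, len] <;> omega

end Cmd

/-- The code `Q` stands in `P` from position `l` on. -/
def CodeAt (P : Program) (l : ℕ) (Q : Program) : Prop :=
  ∀ i < Q.length, P[l + i]? = Q[i]?

theorem CodeAt.left {P : Program} {l : ℕ} {Q R : Program} (h : CodeAt P l (Q ++ R)) :
    CodeAt P l Q := by
  intro i hi
  rw [h i (by simp; omega), List.getElem?_append_left hi]

theorem CodeAt.right {P : Program} {l : ℕ} {Q R : Program} (h : CodeAt P l (Q ++ R)) :
    CodeAt P (l + Q.length) R := by
  intro i hi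
  have := h (Q.length + i) (by simp; omega)
  rw [List.getElem?_append_right (by omega)] at this
  simpa [add_assoc] using this

theorem CodeAt.head {P : Program} {l : ℕ} {i : Instr} {Q : Program} (h : CodeAt P l (i :: Q)) :
    P[l]? = some i := by
  simpa using h 0 (by simp)

theorem CodeAt.tail {P : Program} {l : ℕ} {i : Instr} {Q : Program} (h : CodeAt P l (i :: Q)) :
    CodeAt P (l + 1) Q :=
  CodeAt.right (Q := [i]) h

/-- `P` takes the configuration `x` in at most `T` steps to one that satisfies `Q`, and all
words on the way are at most `B`. -/
def Reaches (P : Program) (B T : ℕ) (x : Config) (Q : Config → Prop) : Prop :=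
  ∃ t ≤ T, (∀ t' ≤ t, WordsAtMost B (run P x t')) ∧ Q (run P x t)

theorem run_add (P : Program) (x : Config) (a b : ℕ) :
    run P x (a + b) = run P (run P x a) b := by
  rw [run, add_comm, Function.iterate_add_apply]; rfl

theorem run_succ (P : Program) (x : Config) (a : ℕ) : run P x (a + 1) = run P (step P x) a := rfl

theorem Reaches.refl {P : Program} {B T : ℕ} {x : Config} {Q : Config → Prop}
    (hx : WordsAtMost B x) (h : Q x) : Reaches P B T x Q :=
  ⟨0, Nat.zero_le _, fun t' ht' => by obtain rfl := Nat.le_zero.1 ht'; exact hx, h⟩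

theorem Reaches.step {P : Program} {B T : ℕ} {x : Config} {Q : Config → Prop} {i : Instr}
    (hx : WordsAtMost B x) (hi : P[x.pc]? = some i) (h : Reaches P B T (i.exec x) Q) :
    Reaches P B (T + 1) x Q := by
  obtain ⟨t, ht, hw, hq⟩ := h
  have hs : RAM.step P x = i.exec x := by simp [RAM.step, hi]
  refine ⟨t + 1, by omega, fun t' ht' => ?_, ?_⟩
  · cases t' with
    | zero => exact hx
    | succ t' => rw [run_succ, hs]; exact hw t' (by omega)
  · rw [run_succ, hs]; exact hq

theorem Reaches.trans {P : Program} {B T₁ T₂ : ℕ} {x : Config} {Q R : Config → Prop}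
    (h : Reaches P B T₁ x Q) (h' : ∀ y, WordsAtMost B y → Q y → Reaches P B T₂ y R) :
    Reaches P B (T₁ + T₂) x R := by
  obtain ⟨t, ht, hw, hq⟩ := h
  obtain ⟨t₂, ht₂, hw₂, hq₂⟩ := h' _ (hw t le_rfl) hq
  refine ⟨t + t₂, by omega, fun t' ht' => ?_, by rwa [run_add]⟩
  rcases le_total t' t with h | h
  · exact hw t' h
  · obtain ⟨u, rfl⟩ := Nat.exists_eq_add_of_le h
    rw [run_add]; exact hw₂ u (by omega)

theorem Reaches.mono {P : Program} {B T T' : ℕ} {x : Config} {Q R : Config → Prop}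
    (h : Reaches P B T x Q) (hT : T ≤ T') (h' : ∀ y, Q y → R y) : Reaches P B T' x R := by
  obtain ⟨t, ht, hw, hq⟩ := h
  exact ⟨t, ht.trans hT, hw, h' _ hq⟩

/-- Started with registers `r` and memory `m`, the structured program `c` ends after at most
`T` steps with registers and memory satisfying `Q`, and all words on the way are at most `B`,
if they are so at the beginning. -/
def Does (B : ℕ) (c : Cmd) (T : ℕ) (r m : ℕ → ℕ) (Q : (ℕ → ℕ) → (ℕ → ℕ) → Prop) : Prop :=
  ∀ P l, CodeAt P l (c.compile l) → WordsAtMost B ⟨l, r, m⟩ →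
    Reaches P B T ⟨l, r, m⟩ fun y => y.pc = l + c.len ∧ Q y.reg y.mem

theorem WordsAtMost.setReg {B : ℕ} {x : Config} (hx : WordsAtMost B x) {a v : ℕ} (hv : v ≤ B) :
    WordsAtMost B (x.setReg a v) := by
  refine ⟨fun b => ?_, hx.2⟩
  simp only [Config.setReg, Function.update_apply]
  split_ifs
  · exact hv
  · exact hx.1 b

section Rules

variable {B T T₁ T₂ : ℕ} {r m : ℕ → ℕ} {Q R : (ℕ → ℕ) → (ℕ → ℕ) → Prop}

theorem Does.mono {c : Cmd} {T' : ℕ} (h : Does B c T r m Q) (hT : T ≤ T')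
    (h' : ∀ r m, Q r m → R r m) : Does B c T' r m R :=
  fun P l hP hx => (h P l hP hx).mono hT fun _ hy => ⟨hy.1, h' _ _ hy.2⟩

theorem Does.seq {c d : Cmd} (h : Does B c T₁ r m fun r' m' => Does B d T₂ r' m' Q) :
    Does B (c ;; d) (T₁ + T₂) r m Q := by
  intro P l hP hx
  rw [Cmd.compile] at hP
  refine (h P l hP.left hx).trans ?_
  rintro ⟨pc, r', m'⟩ hy ⟨rfl, hq⟩
  have hP' := hP.right
  rw [Cmd.length_compile] at hP'
  refine (hq P _ hP' hy).mono le_rfl ?_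
  rintro y ⟨hy, hq⟩
  exact ⟨by rw [hy, Cmd.len, add_assoc], hq⟩

theorem Does.op {i : Instr}
    (h : ∀ l, WordsAtMost B ⟨l, r, m⟩ → WordsAtMost B (i.exec ⟨l, r, m⟩) ∧
      (i.exec ⟨l, r, m⟩).pc = l + 1 ∧ Q (i.exec ⟨l, r, m⟩).reg (i.exec ⟨l, r, m⟩).mem) :
    Does B (.op i) 1 r m Q := by
  intro P l hP hx
  have := h l hx
  exact Reaches.step (T := 0) hx (CodeAt.head hP) (Reaches.refl this.1 this.2)

theorem Does.const {a c : ℕ} (hc : c ≤ B) (h : Q (Function.update r a c) m) :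
    Does B (.op (.const a c)) 1 r m Q :=
  Does.op fun _ hx => ⟨hx.setReg hc, rfl, h⟩

theorem Does.copy {a b : ℕ} (h : Q (Function.update r a (r b)) m) :
    Does B (.op (.copy a b)) 1 r m Q :=
  Does.op fun _ hx => ⟨hx.setReg (hx.1 b), rfl, h⟩

theorem Does.add {a b c : ℕ} (hB : r b + r c ≤ B) (h : Q (Function.update r a (r b + r c)) m) :
    Does B (.op (.add a b c)) 1 r m Q :=
  Does.op fun _ hx => ⟨hx.setReg hB, rfl, h⟩

theorem Does.sub {a b c : ℕ} (h : Q (Function.update r a (r b - r c)) m) :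
    Does B (.op (.sub a b c)) 1 r m Q :=
  Does.op fun _ hx => ⟨hx.setReg ((Nat.sub_le _ _).trans (hx.1 b)), rfl, h⟩

theorem Does.mul {a b c : ℕ} (hB : r b * r c ≤ B) (h : Q (Function.update r a (r b * r c)) m) :
    Does B (.op (.mul a b c)) 1 r m Q :=
  Does.op fun _ hx => ⟨hx.setReg hB, rfl, h⟩

theorem Does.div {a b c : ℕ} (h : Q (Function.update r a (r b / r c)) m) :
    Does B (.op (.div a b c)) 1 r m Q :=
  Does.op fun _ hx => ⟨hx.setReg ((Nat.div_le_self _ _).trans (hx.1 b)), rfl, h⟩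

theorem Does.load {a b : ℕ} (h : Q (Function.update r a (m (r b))) m) :
    Does B (.op (.load a b)) 1 r m Q :=
  Does.op fun _ hx => ⟨hx.setReg (hx.2 _), rfl, h⟩

theorem Does.store {a b : ℕ} (h : Q r (Function.update m (r a) (r b))) :
    Does B (.op (.store a b)) 1 r m Q := by
  refine Does.op fun _ hx => ⟨⟨hx.1, fun c => ?_⟩, rfl, h⟩
  simp only [Instr.exec, Function.update_apply]
  split_ifs
  · exact hx.1 b
  · exact hx.2 c

theorem Does.ifEq {a b : ℕ} {c d : Cmd} (hc : r a = r b → Does B c T r m Q)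
    (hd : r a ≠ r b → Does B d T r m Q) : Does B (.ifEq a b c d) (T + 2) r m Q := by
  intro P l hP hx
  rw [Cmd.compile] at hP
  have h1 := hP.tail.right
  rw [Cmd.length_compile] at h1
  by_cases hab : r a = r b
  · refine (Reaches.step hx hP.head ?_).mono (Nat.le_succ _) fun _ h => h
    have h2 := h1.tail
    simp only [Instr.exec, hab, if_true]
    have : l + 1 + d.len + 1 = l + d.len + 2 := by ring
    rw [this] at h2
    refine (hc hab P _ h2 hx).mono le_rfl ?_
    rintro y ⟨hy, hq⟩
    exact ⟨by rw [hy, Cmd.len]; ring, hq⟩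
  · refine Reaches.step (T := T + 1) hx hP.head ?_
    simp only [Instr.exec, hab, if_false]
    refine Reaches.trans (hd hab P _ hP.tail.left hx) ?_
    rintro ⟨pc, r', m'⟩ hy ⟨rfl, hq⟩
    refine Reaches.step (T := 0) hy h1.head (Reaches.refl hy ⟨?_, hq⟩)
    simp only [Instr.exec, Cmd.len]; ring

theorem Does.ifLt {a b : ℕ} {c d : Cmd} (hc : r a < r b → Does B c T r m Q)
    (hd : r b ≤ r a → Does B d T r m Q) : Does B (.ifLt a b c d) (T + 2) r m Q := by
  intro P l hP hx
  rw [Cmd.compile] at hP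
  have h1 := hP.tail.right
  rw [Cmd.length_compile] at h1
  by_cases hab : r a < r b
  · refine (Reaches.step hx hP.head ?_).mono (Nat.le_succ _) fun _ h => h
    have h2 := h1.tail
    simp only [Instr.exec, hab, if_true]
    have : l + 1 + d.len + 1 = l + d.len + 2 := by ring
    rw [this] at h2
    refine (hc hab P _ h2 hx).mono le_rfl ?_
    rintro y ⟨hy, hq⟩
    exact ⟨by rw [hy, Cmd.len]; ring, hq⟩
  · refine Reaches.step (T := T + 1) hx hP.head ?_
    simp only [Instr.exec, hab, if_false]
    refine Reaches.trans (hd (not_lt.1 hab) P _ hP.tail.left hx) ?_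
    rintro ⟨pc, r', m'⟩ hy ⟨rfl, hq⟩
    refine Reaches.step (T := 0) hy h1.head (Reaches.refl hy ⟨?_, hq⟩)
    simp only [Instr.exec, Cmd.len]; ring

/-- The rule for loops: `I p` is the invariant, where `p` is the time that is still allowed. -/
theorem Does.whileLt {a b : ℕ} {c : Cmd} (I : ℕ → (ℕ → ℕ) → (ℕ → ℕ) → Prop) (p : ℕ)
    (h0 : I p r m)
    (hI : ∀ p r m, I p r m → r a < r b →
      ∃ T ≤ p, Does B c T r m fun r' m' => ∃ p', T + 1 + p' ≤ p ∧ I p' r' m')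
    (hQ : ∀ p r m, I p r m → r b ≤ r a → Q r m) :
    Does B (.whileLt a b c) (p + 2) r m Q := by
  intro P l hP hx
  rw [Cmd.compile] at hP
  have h1 := hP.tail.right
  rw [Cmd.length_compile] at h1
  have hl : l + 1 + c.len = l + c.len + 1 := by ring
  rw [hl] at h1
  have key : ∀ p r m, I p r m → WordsAtMost B ⟨l + c.len + 1, r, m⟩ →
      Reaches P B (p + 1) ⟨l + c.len + 1, r, m⟩
        fun y => y.pc = l + (Cmd.whileLt a b c).len ∧ Q y.reg y.mem := by
    intro p
    induction p using Nat.strong_induction_on with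
    | _ p ih =>
      intro r m hr hx
      refine Reaches.step hx h1.head ?_
      by_cases hab : r a < r b
      · simp only [Instr.exec, hab, if_true]
        obtain ⟨T, hT, hd⟩ := hI p r m hr hab
        have h2 := hd P _ hP.tail.left hx
        refine Reaches.mono (T := T + (p - T)) ?_ (by omega) fun _ h => h
        refine h2.trans ?_
        rintro ⟨pc, r', m'⟩ hy ⟨rfl, p', hp', hi⟩
        rw [hl] at hy ⊢
        exact (ih p' (by omega) r' m' hi hy).mono (by omega) fun _ h => h
      · simp only [Instr.exec, hab, if_false]
        refine Reaches.refl hx ⟨?_, hQ p r m hr (not_lt.1 hab)⟩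
        simp only [Cmd.len]; ring
  refine Reaches.step hx hP.head ?_
  exact key p r m h0 hx

end Rules

end RAM

/-! ### Trees as rooted trees -/

namespace Firefighter

/-- `G` is the tree with root `s` in which `v` has the parent `par v` and the depth `d v`.
The root is its own parent, so that `d (par v) = d v - 1` holds for all vertices with
truncated subtraction. -/
structure IsRooting {V : Type*} (G : SimpleGraph V) (s : V) (par : V → V) (d : V → ℕ) : Prop where
  depth_eq_zero : ∀ v, d v = 0 ↔ v = s
  depth_par : ∀ v, d (par v) = d v - 1
  adj_iff : ∀ u v, G.Adj u v ↔ (par v = u ∧ d v = d u + 1) ∨ (par u = v ∧ d u = d v + 1)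

/-- `a` is an ancestor of `u`, possibly `u` itself. -/
def Anc {V : Type*} (par : V → V) (a u : V) : Prop := ∃ j, par^[j] u = a

theorem exists_adj_of_ne {V : Type*} {G : SimpleGraph V} (hG : G.IsTree) {s v : V} (h : v ≠ s) :
    ∃ u, G.Adj u v ∧ G.dist s v = G.dist s u + 1 := by
  obtain ⟨p, hp⟩ := hG.connected.exists_walk_length_eq_dist v s
  cases p with
  | nil => exact absurd rfl h
  | @cons _ u _ hadj q =>
    refine ⟨u, hadj.symm, ?_⟩
    have h1 := SimpleGraph.dist_le q
    rw [SimpleGraph.Walk.length_cons] at hp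
    rw [SimpleGraph.dist_comm] at h1 hp
    rcases hG.dist_eq_dist_add_one_of_adj s hadj with h2 | h2 <;> omega

theorem eq_of_adj_of_dist {V : Type*} {G : SimpleGraph V} (hG : G.IsTree) {s v u u' : V}
    (h : G.Adj u v) (hd : G.dist s v = G.dist s u + 1) (h' : G.Adj u' v)
    (hd' : G.dist s v = G.dist s u' + 1) : u = u' := by
  obtain ⟨p, hp⟩ := hG.connected.exists_walk_length_eq_dist s u
  obtain ⟨p', hp'⟩ := hG.connected.exists_walk_length_eq_dist s u'
  have h1 : (p.concat h).IsPath :=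
    SimpleGraph.Walk.isPath_of_length_eq_dist _ (by rw [SimpleGraph.Walk.length_concat, hp, hd])
  have h2 : (p'.concat h').IsPath :=
    SimpleGraph.Walk.isPath_of_length_eq_dist _ (by rw [SimpleGraph.Walk.length_concat, hp', hd'])
  have h3 := (hG.existsUnique_path s v).unique h1 h2
  have := congrArg SimpleGraph.Walk.penultimate h3
  simpa using this

theorem exists_isRooting {V : Type*} {G : SimpleGraph V} (hG : G.IsTree) (s : V) :
    ∃ par d, IsRooting G s par d := by
  classical
  have hpar : ∀ v, ∃ u, if v = s then u = s else G.Adj u v ∧ G.dist s v = G.dist s u + 1 := by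
    intro v
    by_cases h : v = s
    · exact ⟨s, by simp [h]⟩
    · obtain ⟨u, hu⟩ := exists_adj_of_ne hG h
      exact ⟨u, by simpa [h] using hu⟩
  choose par hpar using hpar
  have h0 : ∀ v, G.dist s v = 0 ↔ v = s := fun v => by
    rw [hG.connected.dist_eq_zero_iff, eq_comm]
  have hne : ∀ u v, G.Adj u v → G.dist s v = G.dist s u + 1 → par v = u := by
    intro u v h hd
    have hv : v ≠ s := fun hv => by rw [(h0 v).2 hv] at hd; omega
    have := hpar v
    rw [if_neg hv] at this
    exact eq_of_adj_of_dist hG this.1 this.2 h hd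
  refine ⟨par, G.dist s, h0, fun v => ?_, fun u v => ⟨fun h => ?_, ?_⟩⟩
  · have := hpar v
    split_ifs at this with hv
    · rw [this, hv]; simp
    · omega
  · rcases hG.dist_eq_dist_add_one_of_adj s h with hd | hd
    · exact Or.inr ⟨hne v u h.symm hd, hd⟩
    · exact Or.inl ⟨hne u v h hd, hd⟩
  · have key : ∀ u v, par v = u → G.dist s v = G.dist s u + 1 → G.Adj u v := by
      intro u v h hd
      have hv : v ≠ s := fun hv => by rw [(h0 v).2 hv] at hd; omega
      have := hpar v
      rw [if_neg hv, h] at this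
      exact this.1
    rintro (h | h)
    · exact key u v h.1 h.2
    · exact (key v u h.1 h.2).symm

section Rooting

variable {V : Type*} {G : SimpleGraph V} {s : V} {par : V → V} {d : V → ℕ}

theorem Anc.refl (u : V) : Anc par u u := ⟨0, rfl⟩

theorem Anc.trans {a b u : V} (h : Anc par a b) (h' : Anc par b u) : Anc par a u := by
  obtain ⟨i, rfl⟩ := h
  obtain ⟨j, rfl⟩ := h'
  exact ⟨i + j, Function.iterate_add_apply _ _ _ _⟩

theorem anc_par (u : V) : Anc par (par u) u := ⟨1, rfl⟩

/-- An ancestor of `u` is `u` or an ancestor of the parent of `u`. -/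
theorem Anc.eq_or_par {a u : V} (h : Anc par a u) : a = u ∨ Anc par a (par u) := by
  obtain ⟨j, rfl⟩ := h
  cases j with
  | zero => exact Or.inl rfl
  | succ j => exact Or.inr ⟨j, rfl⟩

/-- Two ancestors of the same vertex are comparable. -/
theorem Anc.total {a b u : V} (h : Anc par a u) (h' : Anc par b u) : Anc par a b ∨ Anc par b a := by
  obtain ⟨i, rfl⟩ := h
  obtain ⟨j, rfl⟩ := h'
  rcases le_total i j with hij | hij
  · obtain ⟨l, rfl⟩ := Nat.exists_eq_add_of_le hij
    exact Or.inr ⟨l, by rw [add_comm, Function.iterate_add_apply]⟩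
  · obtain ⟨l, rfl⟩ := Nat.exists_eq_add_of_le hij
    exact Or.inl ⟨l, by rw [add_comm, Function.iterate_add_apply]⟩

namespace IsRooting

theorem depth_iterate (h : IsRooting G s par d) (j : ℕ) (v : V) : d (par^[j] v) = d v - j := by
  induction j generalizing v with
  | zero => rfl
  | succ j ih => rw [Function.iterate_succ_apply, ih, h.depth_par]; omega

theorem par_root (h : IsRooting G s par d) : par s = s := by
  rw [← h.depth_eq_zero, h.depth_par, (h.depth_eq_zero s).2 rfl]

theorem par_adj (h : IsRooting G s par d) {v : V} (hv : v ≠ s) : G.Adj (par v) v := by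
  have := h.depth_par v
  have h0 := mt (h.depth_eq_zero v).1 hv
  exact (h.adj_iff _ _).2 (Or.inl ⟨rfl, by omega⟩)

theorem anc_le (h : IsRooting G s par d) {a u : V} (ha : Anc par a u) : d a ≤ d u := by
  obtain ⟨j, rfl⟩ := ha
  rw [h.depth_iterate]; omega

theorem anc_eq (h : IsRooting G s par d) {a u : V} (ha : Anc par a u) (hd : d a = d u) :
    a = u := by
  obtain ⟨j, rfl⟩ := ha
  rw [h.depth_iterate] at hd
  rcases Nat.eq_zero_or_pos j with rfl | hj
  · rfl
  · have hu : u = s := (h.depth_eq_zero u).1 (by omega)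
    rw [hu, Function.iterate_fixed h.par_root]

theorem anc_root (h : IsRooting G s par d) (u : V) : Anc par s u :=
  ⟨d u, by rw [← h.depth_eq_zero, h.depth_iterate]; omega⟩

/-! ### Fires in rooted trees -/

theorem depth_le_of_burning (h : IsRooting G s par d) {σ : Strategy V} {t : ℕ} :
    ∀ {u}, u ∈ burning G s σ t → d u ≤ t := by
  induction t with
  | zero => intro u hu; exact ((h.depth_eq_zero u).2 hu).le
  | succ t ih =>
    rintro u (hu | ⟨-, v, hv, hadj⟩)
    · exact (ih hu).trans (Nat.le_succ t)
    · have := ih hv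
      rcases (h.adj_iff _ _).1 hadj with h | h <;> omega

/-- The fire reaches `u` after `d u` steps, unless an ancestor of `u` has been protected in time. -/
theorem exists_guard_of_not_burning (h : IsRooting G s par d) {σ : Strategy V} {u : V}
    (hu : u ∉ burning G s σ (d u)) : ∃ a t, Anc par a u ∧ t < d a ∧ σ t = some a := by
  induction hd : d u generalizing u with
  | zero =>
    rw [(h.depth_eq_zero u).1 hd, (h.depth_eq_zero s).2 rfl] at hu
    exact absurd rfl hu
  | succ j ih =>
    have hp : d (par u) = j := by rw [h.depth_par]; omega
    have hus : u ≠ s := fun hs => by rw [(h.depth_eq_zero u).2 hs] at hd; omega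
    by_cases hb : par u ∈ burning G s σ (d (par u))
    · have hg : u ∈ guarded σ (d u) := by
        by_contra hg
        rw [hp] at hb
        rw [hd] at hu hg
        exact hu (Or.inr ⟨hg, par u, hb, h.par_adj hus⟩)
      obtain ⟨t, ht, hσ⟩ := hg
      exact ⟨u, t, Anc.refl u, ht, hσ⟩
    · obtain ⟨a, t, ha, ht, hσ⟩ := ih hb hp
      exact ⟨a, t, ha.trans (anc_par u), ht, hσ⟩

/-- The descendants of a vertex that is protected in time are saved. -/
theorem mem_saved_of_guard (h : IsRooting G s par d) {σ : Strategy V} {a u : V} {t : ℕ}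
    (ht : t < d a) (hσ : σ t = some a) (ha : Anc par a u) : u ∈ saved G s σ := by
  intro T
  induction T generalizing u with
  | zero =>
    rintro rfl
    have := h.anc_le ha
    rw [(h.depth_eq_zero _).2 rfl] at this
    omega
  | succ T ih =>
    rintro (hu | ⟨hg, x, hx, hadj⟩)
    · exact ih ha hu
    · rcases (h.adj_iff _ _).1 hadj with ⟨rfl, h2⟩ | ⟨rfl, h2⟩
      · rcases ha.eq_or_par with rfl | ha
        · have hT : T + 1 ≤ t := by
            by_contra hT
            exact hg ⟨t, by omega, hσ⟩
          have := h.depth_le_of_burning hx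
          omega
        · exact ih ha hx
      · exact ih (ha.trans (anc_par x)) hx

/-- A list of vertices of the depths `1, 2, …` is a feasible strategy. -/
theorem isFeasible_ofList (h : IsRooting G s par d) {p : List V} {k : ℕ} (hk : p.length ≤ k)
    (hp : ∀ (i : ℕ) (hi : i < p.length), d p[i] = i + 1) :
    IsFeasible G s k (Strategy.ofList p) := by
  constructor
  · intro t v hv hb
    obtain ⟨ht, rfl⟩ := List.getElem?_eq_some_iff.1 hv
    have := h.depth_le_of_burning hb
    rw [hp t ht] at this
    omega
  · have : {t | Strategy.ofList p t ≠ none} = ↑(Finset.range p.length) := by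
      ext t; simp [Strategy.ofList]
    rw [this, Set.encard_coe_eq_coe_finsetCard, Finset.card_range]
    exact_mod_cast hk

/-- A strategy may be replaced by the choice of at most one vertex of each of the depths
`1, …, k`: the vertex that is protected as the `j`-th one, which has depth at least `j` if it
is of use, is replaced by its ancestor of depth `j`. -/
theorem exists_selection (h : IsRooting G s par d) {σ : Strategy V} {k : ℕ}
    (hσ : {t | σ t ≠ none}.encard ≤ k) :
    ∃ A : Set V, (∀ a ∈ A, ∀ b ∈ A, d a = d b → a = b) ∧ (∀ a ∈ A, 1 ≤ d a ∧ d a ≤ k) ∧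
      ∀ u ∈ saved G s σ, ∃ a ∈ A, Anc par a u := by
  classical
  have hfin : {t | σ t ≠ none}.Finite :=
    Set.finite_of_encard_le_coe hσ
  set T := hfin.toFinset with hT
  have hmem : ∀ t, t ∈ T ↔ σ t ≠ none := fun t => by simp [hT]
  have hcard : T.card ≤ k := by
    rw [hfin.encard_eq_coe_toFinset_card] at hσ
    exact_mod_cast hσ
  set rank : ℕ → ℕ := fun t => (T.filter (· ≤ t)).card with hrank
  have hle : ∀ t, rank t ≤ t + 1 := fun t => by
    refine (Finset.card_le_card (t := Finset.range (t + 1)) fun x hx => ?_).trans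
      (Finset.card_range _).le
    have := (Finset.mem_filter.1 hx).2
    simp; omega
  have hpos : ∀ t ∈ T, 1 ≤ rank t := fun t ht =>
    Finset.card_pos.2 ⟨t, by simp [ht]⟩
  have hlt : ∀ t ∈ T, ∀ t' < t, rank t' < rank t := fun t ht t' htt =>
    Finset.card_lt_card ⟨fun x hx => by simp at hx ⊢; exact ⟨hx.1, by omega⟩, fun hsub => by
      have := hsub (Finset.mem_filter.2 ⟨ht, le_rfl⟩)
      simp at this; omega⟩
  have hinj : ∀ t ∈ T, ∀ t' ∈ T, rank t = rank t' → t = t' := by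
    intro t ht t' ht' hr
    rcases lt_trichotomy t t' with hl | hl | hl
    · exact absurd hr (hlt t' ht' t hl).ne
    · exact hl
    · exact absurd hr (hlt t ht t' hl).ne'
  refine ⟨{a' | ∃ t a, σ t = some a ∧ rank t ≤ d a ∧ a' = par^[d a - rank t] a}, ?_, ?_, ?_⟩
  · rintro _ ⟨t, a, hσa, hra, rfl⟩ _ ⟨t', b, hσb, hrb, rfl⟩ hd
    rw [h.depth_iterate, h.depth_iterate] at hd
    have := hinj t ((hmem t).2 (by simp [hσa])) t' ((hmem t').2 (by simp [hσb])) (by omega)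
    subst this
    rw [hσa] at hσb
    cases hσb
    rfl
  · rintro _ ⟨t, a, hσa, hra, rfl⟩
    rw [h.depth_iterate]
    have h1 := hpos t ((hmem t).2 (by simp [hσa]))
    have h2 : rank t ≤ T.card := Finset.card_le_card (Finset.filter_subset _ _)
    omega
  · intro u hu
    obtain ⟨a, t, ha, ht, hσa⟩ := h.exists_guard_of_not_burning (hu (d u))
    have := hle t
    exact ⟨_, ⟨t, a, hσa, by omega, rfl⟩, Anc.trans ⟨_, rfl⟩ ha⟩

end IsRooting

end Rooting

end Firefighter

namespace Firefighter

/-! ### Depth-first search with a stack -/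

section Search

variable {V : Type*} {G : SimpleGraph V} {s : V} {par : V → V} {d : V → ℕ} {ch : V → List V}

/-- The descendants of the vertices of a list. -/
def forest (par : V → V) (L : List V) : Set V := {u | ∃ v ∈ L, Anc par v u}

/-- The number of descendants of `v`, which is the number of vertices that the protection
of `v` saves. -/
noncomputable def size (par : V → V) (v : V) : ℕ := {u | Anc par v u}.ncard

/-- The lists `ch v` enumerate the children of the vertices `v`. -/
def IsChildren (par : V → V) (d : V → ℕ) (ch : V → List V) : Prop :=
  ∀ v, (ch v).Nodup ∧ ∀ c, c ∈ ch v ↔ par c = v ∧ d c = d v + 1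

/-- One step of the depth-first search: the first vertex of the stack is replaced by its
children. -/
def dfsStep (ch : V → List V) : List V → List V
  | [] => []
  | v :: L => ch v ++ L

/-- The stack after `i` steps of the depth-first search. -/
def dfsStack (ch : V → List V) (s : V) (i : ℕ) : List V := (dfsStep ch)^[i] [s]

/-- The `i`-th vertex (counted from `0`) in the order of the depth-first search. -/
def dfsOrder (ch : V → List V) (s : V) (i : ℕ) : V := (dfsStack ch s i).headD s

/-- No two subtrees at different places of the list intersect. -/
def Indep (par : V → V) (L : List V) : Prop :=
  L.Pairwise fun a b => ∀ u, Anc par a u → ¬Anc par b u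

theorem size_pos [Finite V] (par : V → V) (v : V) : 0 < size par v :=
  (Set.ncard_pos).2 ⟨v, Anc.refl v⟩

theorem forest_nil : forest par ([] : List V) = ∅ := by simp [forest]

theorem forest_cons (v : V) (L : List V) :
    forest par (v :: L) = {u | Anc par v u} ∪ forest par L := by
  ext u; simp [forest]

theorem forest_append (L L' : List V) : forest par (L ++ L') = forest par L ∪ forest par L' := by
  ext u; simp [forest, or_and_right, exists_or]

theorem mem_forest_of_anc {a u : V} {L : List V} (ha : a ∈ forest par L) (h : Anc par a u) :
    u ∈ forest par L := by
  obtain ⟨v, hv, hva⟩ := ha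
  exact ⟨v, hv, hva.trans h⟩

theorem dfsStack_succ (i : ℕ) : dfsStack ch s (i + 1) = dfsStep ch (dfsStack ch s i) :=
  Function.iterate_succ_apply' _ _ _

theorem Indep.notMem {v u : V} {L : List V} (h : Indep par (v :: L)) (hu : Anc par v u) :
    u ∉ forest par L := by
  rintro ⟨w, hw, hwu⟩
  exact (List.pairwise_cons.1 h).1 w hw u hu hwu

theorem Indep.ncard_forest [Finite V] {L : List V} (h : Indep par L) :
    (forest par L).ncard = (L.map (size par)).sum := by
  induction L with
  | nil => simp [forest_nil]
  | cons v L ih =>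
    rw [forest_cons, Set.ncard_union_eq, ih (List.pairwise_cons.1 h).2, List.map_cons,
      List.sum_cons, size]
    exact Set.disjoint_left.2 fun u hu => h.notMem hu

namespace IsRooting

theorem eq_or_child (h : IsRooting G s par d) {v u : V} (hu : Anc par v u) :
    u = v ∨ ∃ c, par c = v ∧ d c = d v + 1 ∧ Anc par c u := by
  obtain ⟨j, hj⟩ := hu
  induction j with
  | zero => exact Or.inl hj
  | succ j ih =>
    rw [Function.iterate_succ_apply'] at hj
    rcases Nat.eq_zero_or_pos (d (par^[j] u)) with h0 | h0
    · have := (h.depth_eq_zero _).1 h0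
      rw [this, h.par_root] at hj
      exact ih (this.trans hj)
    · refine Or.inr ⟨_, hj, ?_, j, rfl⟩
      rw [← hj, h.depth_par]; omega

theorem mem_forest_children (h : IsRooting G s par d) (hch : IsChildren par d ch) {v u : V} :
    u ∈ forest par (ch v) ↔ Anc par v u ∧ u ≠ v := by
  constructor
  · rintro ⟨c, hc, hcu⟩
    obtain ⟨rfl, hd⟩ := ((hch v).2 c).1 hc
    refine ⟨(anc_par c).trans hcu, ?_⟩
    rintro rfl
    have := h.anc_le hcu
    omega
  · rintro ⟨hu, hne⟩
    obtain ⟨c, h1, h2, h3⟩ := (h.eq_or_child hu).resolve_left hne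
    exact ⟨c, ((hch v).2 c).2 ⟨h1, h2⟩, h3⟩

theorem indep_children (h : IsRooting G s par d) (hch : IsChildren par d ch) (v : V) :
    Indep par (ch v) := by
  refine (hch v).1.imp_of_mem fun {a b} ha hb hab u hau hbu => hab ?_
  have ha := (((hch v).2 a).1 ha).2
  have hb := (((hch v).2 b).1 hb).2
  rcases hau.total hbu with hx | hx
  · exact h.anc_eq hx (by omega)
  · exact (h.anc_eq hx (by omega)).symm

theorem indep_dfsStep (h : IsRooting G s par d) (hch : IsChildren par d ch) {L : List V}
    (hL : Indep par L) : Indep par (dfsStep ch L) := by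
  cases L with
  | nil => exact hL
  | cons v L =>
    refine List.pairwise_append.2
      ⟨h.indep_children hch v, (List.pairwise_cons.1 hL).2, fun a ha b hb u hau hbu => ?_⟩
    have := (h.mem_forest_children hch).1 ⟨a, ha, hau⟩
    exact (List.pairwise_cons.1 hL).1 b hb u this.1 hbu

theorem indep_dfsStack (h : IsRooting G s par d) (hch : IsChildren par d ch) (i : ℕ) :
    Indep par (dfsStack ch s i) := by
  induction i with
  | zero => simp [dfsStack, Indep]
  | succ i ih => rw [dfsStack_succ]; exact h.indep_dfsStep hch ih

theorem size_eq [Finite V] (h : IsRooting G s par d) (hch : IsChildren par d ch) (v : V) :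
    size par v = ((ch v).map (size par)).sum + 1 := by
  rw [← (h.indep_children hch v).ncard_forest, ← Set.ncard_insert_of_notMem (a := v)]
  · rw [size]
    congr 1
    ext u
    simp only [Set.mem_ofPred_eq, Set.mem_insert_iff, h.mem_forest_children hch]
    constructor
    · intro hu
      by_cases huv : u = v
      · exact Or.inl huv
      · exact Or.inr ⟨hu, huv⟩
    · rintro (rfl | hu)
      · exact Anc.refl u
      · exact hu.1
  · exact fun hv => ((h.mem_forest_children hch).1 hv).2 rfl

/-- The search removes the subtrees of the first vertices of the stack before it touches the
rest of the stack.  Hence the descendants of a vertex are consecutive in the search order. -/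
theorem dfsStep_iterate_append [Finite V] (h : IsRooting G s par d) (hch : IsChildren par d ch)
    (A L : List V) : (dfsStep ch)^[(A.map (size par)).sum] (A ++ L) = L := by
  induction hN : (A.map (size par)).sum generalizing A with
  | zero =>
    cases A with
    | nil => rfl
    | cons v A => have := size_pos par v; simp at hN; omega
  | succ N ih =>
    cases A with
    | nil => simp at hN
    | cons v A =>
      rw [Function.iterate_succ_apply, List.cons_append, dfsStep, ← List.append_assoc]
      apply ih
      rw [List.map_cons, List.sum_cons, h.size_eq hch] at hN
      rw [List.map_append, List.sum_append]
      omega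

theorem size_root [Finite V] (h : IsRooting G s par d) : size par s = Nat.card V := by
  rw [size, ← Set.ncard_univ]
  congr 1
  ext u
  simpa using h.anc_root u

/-- Each step of the search takes one vertex, so the subtrees of the stack contain the others. -/
theorem sum_size_dfsStack [Finite V] (h : IsRooting G s par d) (hch : IsChildren par d ch) {i : ℕ}
    (hi : i ≤ Nat.card V) : ((dfsStack ch s i).map (size par)).sum + i = Nat.card V := by
  induction i with
  | zero => simp [dfsStack, h.size_root]
  | succ i ih =>
    have ih := ih (by omega)
    rw [dfsStack_succ]
    cases hL : dfsStack ch s i with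
    | nil => rw [hL] at ih; simp at ih; omega
    | cons v L =>
      rw [hL, List.map_cons, List.sum_cons, h.size_eq hch] at ih
      rw [dfsStep, List.map_append, List.sum_append]
      omega

theorem length_dfsStack_le [Finite V] (h : IsRooting G s par d) (hch : IsChildren par d ch) {i : ℕ}
    (hi : i ≤ Nat.card V) : (dfsStack ch s i).length + i ≤ Nat.card V := by
  rw [← h.sum_size_dfsStack hch hi]
  have : (dfsStack ch s i).length • 1 ≤ ((dfsStack ch s i).map (size par)).sum := by
    rw [← List.length_map (f := size par)]
    refine List.card_nsmul_le_sum _ _ fun x hx => ?_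
    obtain ⟨v, -, rfl⟩ := List.mem_map.1 hx
    exact size_pos par v
  simpa using this

theorem dfsStack_card [Finite V] (h : IsRooting G s par d) (hch : IsChildren par d ch) :
    dfsStack ch s (Nat.card V) = [] := by
  have := h.length_dfsStack_le hch le_rfl
  exact List.length_eq_zero_iff.1 (by omega)

theorem dfsStack_eq [Finite V] (h : IsRooting G s par d) (hch : IsChildren par d ch) {i : ℕ}
    (hi : i < Nat.card V) :
    dfsStack ch s i = dfsOrder ch s i :: dfsStack ch s (i + size par (dfsOrder ch s i)) := by
  have := h.sum_size_dfsStack hch hi.le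
  cases hL : dfsStack ch s i with
  | nil => rw [hL] at this; simp at this; omega
  | cons v L =>
    have hv : dfsOrder ch s i = v := by simp [dfsOrder, hL]
    rw [hv, dfsStack, add_comm, Function.iterate_add_apply]
    rw [dfsStack] at hL
    rw [hL]
    have := h.dfsStep_iterate_append hch [v] L
    simp only [List.map_cons, List.map_nil, List.sum_cons, List.sum_nil, add_zero] at this
    rw [List.singleton_append] at this
    rw [this]

theorem dfsStack_succ_eq [Finite V] (h : IsRooting G s par d) (hch : IsChildren par d ch) {i : ℕ}
    (hi : i < Nat.card V) : dfsStack ch s (i + 1) =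
      ch (dfsOrder ch s i) ++ dfsStack ch s (i + size par (dfsOrder ch s i)) := by
  rw [dfsStack_succ, h.dfsStack_eq hch hi, dfsStep]

theorem dfsOrder_add_size_le [Finite V] (h : IsRooting G s par d) (hch : IsChildren par d ch)
    {i : ℕ} (hi : i < Nat.card V) : i + size par (dfsOrder ch s i) ≤ Nat.card V := by
  have := h.sum_size_dfsStack hch hi.le
  rw [h.dfsStack_eq hch hi, List.map_cons, List.sum_cons] at this
  omega

theorem forest_dfsStack_succ [Finite V] (h : IsRooting G s par d) (hch : IsChildren par d ch)
    {i : ℕ} (hi : i < Nat.card V) {u : V} : u ∈ forest par (dfsStack ch s i) ↔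
      u = dfsOrder ch s i ∨ u ∈ forest par (dfsStack ch s (i + 1)) := by
  rw [h.dfsStack_succ_eq hch hi, h.dfsStack_eq hch hi, forest_cons, forest_append,
    Set.mem_union, Set.mem_union, h.mem_forest_children hch, Set.mem_ofPred_eq]
  have : Anc par (dfsOrder ch s i) (dfsOrder ch s i) := Anc.refl _
  by_cases hu : u = dfsOrder ch s i
  · rw [hu]; tauto
  · tauto

theorem dfsOrder_notMem [Finite V] (h : IsRooting G s par d) (hch : IsChildren par d ch)
    {i : ℕ} (hi : i < Nat.card V) :
    dfsOrder ch s i ∉ forest par (dfsStack ch s (i + 1)) := by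
  have hI := h.indep_dfsStack hch i
  rw [h.dfsStack_eq hch hi] at hI
  rw [h.dfsStack_succ_eq hch hi, forest_append, Set.mem_union, h.mem_forest_children hch]
  rintro (h1 | h1)
  · exact h1.2 rfl
  · exact hI.notMem (Anc.refl _) h1

theorem forest_dfsStack_anti [Finite V] (h : IsRooting G s par d) (hch : IsChildren par d ch)
    {i j : ℕ} (hij : i ≤ j) (hj : j ≤ Nat.card V) :
    forest par (dfsStack ch s j) ⊆ forest par (dfsStack ch s i) := by
  induction j, hij using Nat.le_induction with
  | base => exact subset_rfl
  | succ j hij ih =>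
    exact fun u hu => ih (by omega) ((h.forest_dfsStack_succ hch (by omega)).2 (Or.inr hu))

theorem exists_dfsOrder_eq [Finite V] (h : IsRooting G s par d) (hch : IsChildren par d ch)
    (u : V) : ∃ i < Nat.card V, dfsOrder ch s i = u := by
  by_contra! hne
  have key : ∀ i ≤ Nat.card V, u ∈ forest par (dfsStack ch s i) := by
    intro i
    induction i with
    | zero => intro _; exact ⟨s, by simp [dfsStack], h.anc_root u⟩
    | succ i ih =>
      intro hi
      exact ((h.forest_dfsStack_succ hch hi).1 (ih (by omega))).resolve_left
        fun hu => hne i hi hu.symm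
  have := key _ le_rfl
  rw [h.dfsStack_card hch, forest_nil] at this
  exact this

theorem dfsOrder_bijective [Finite V] (h : IsRooting G s par d) (hch : IsChildren par d ch) :
    Function.Bijective fun i : Fin (Nat.card V) => dfsOrder ch s i := by
  have : Fintype V := Fintype.ofFinite V
  refine (Fintype.bijective_iff_surjective_and_card _).2 ⟨fun u => ?_, by simp⟩
  obtain ⟨i, hi, hu⟩ := h.exists_dfsOrder_eq hch u
  exact ⟨⟨i, hi⟩, hu⟩

/-- Children come later than their parents in the search order. -/
theorem lt_of_par_dfsOrder [Finite V] (h : IsRooting G s par d) (hch : IsChildren par d ch)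
    {i j : ℕ} (hi : i < Nat.card V) (hj : j < Nat.card V) (hne : dfsOrder ch s j ≠ s)
    (hp : par (dfsOrder ch s j) = dfsOrder ch s i) : i < j := by
  by_contra! hji
  rcases hji.eq_or_lt with rfl | hji
  · have h1 := h.depth_par (dfsOrder ch s j)
    rw [hp] at h1
    exact hne ((h.depth_eq_zero _).1 (by omega))
  · refine h.dfsOrder_notMem hch hj (h.forest_dfsStack_anti hch hji hi.le ?_)
    rw [h.forest_dfsStack_succ hch hi]
    right
    rw [h.dfsStack_succ_eq hch hi, forest_append]
    refine Or.inl ((h.mem_forest_children hch).2 ⟨?_, ?_⟩)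
    · rw [← hp]; exact anc_par _
    · rw [← hp]
      intro he
      have h1 := h.depth_par (dfsOrder ch s j)
      rw [← he] at h1
      exact hne ((h.depth_eq_zero _).1 (by omega))

theorem dfsOrder_ne_root [Finite V] (h : IsRooting G s par d) (hch : IsChildren par d ch)
    {i : ℕ} (hi : i < Nat.card V) (h0 : i ≠ 0) : dfsOrder ch s i ≠ s := by
  intro he
  have := (h.dfsOrder_bijective hch).1 (a₁ := ⟨i, hi⟩) (a₂ := ⟨0, by omega⟩) he
  exact h0 (by simpa using this)

/-- The size of a subtree is the sum of the sizes of the subtrees of the children, all of which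
come later in the search order. -/
theorem size_dfsOrder [Finite V] [DecidableEq V] (h : IsRooting G s par d)
    (hch : IsChildren par d ch) {i l : ℕ} (hi : i < Nat.card V) (hl : 1 ≤ l) (hli : l ≤ i + 1) :
    size par (dfsOrder ch s i) = 1 + ∑ j ∈ Finset.Ico l (Nat.card V),
      if par (dfsOrder ch s j) = dfsOrder ch s i then size par (dfsOrder ch s j) else 0 := by
  have : Fintype V := Fintype.ofFinite V
  have h1 : ((ch (dfsOrder ch s i)).map (size par)).sum =
      ∑ u : V, if par u = dfsOrder ch s i ∧ u ≠ s then size par u else 0 := by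
    rw [← List.sum_toFinset _ (hch _).1, ← Finset.sum_filter]
    refine Finset.sum_congr ?_ fun _ _ => rfl
    ext u
    simp only [List.mem_toFinset, (hch _).2, Finset.mem_filter, Finset.mem_univ, true_and]
    refine and_congr_right fun hu => ?_
    have := h.depth_par u
    rw [hu] at this
    rw [ne_eq, ← h.depth_eq_zero]
    omega
  rw [h.size_eq hch, add_comm, h1, ← (h.dfsOrder_bijective hch).sum_comp,
    Fin.sum_univ_eq_sum_range (fun j => if par (dfsOrder ch s j) = dfsOrder ch s i ∧
      dfsOrder ch s j ≠ s then size par (dfsOrder ch s j) else 0), Finset.range_eq_Ico,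
    ← Finset.sum_Ico_consecutive _ (Nat.zero_le l) (hli.trans hi), Finset.sum_eq_zero, zero_add]
  · congr 1
    refine Finset.sum_congr rfl fun j hj => ?_
    rw [Finset.mem_Ico] at hj
    simp [h.dfsOrder_ne_root hch hj.2 (by omega)]
  · intro j hj
    rw [Finset.mem_Ico] at hj
    refine if_neg fun hp => ?_
    have := h.lt_of_par_dfsOrder hch hi (by omega) hp.2 hp.1
    omega

theorem depth_lt_card [Finite V] (h : IsRooting G s par d) (v : V) : d v < Nat.card V := by
  have : Fintype V := Fintype.ofFinite V
  have hinj : Function.Injective fun j : Fin (d v + 1) => par^[j] v := by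
    intro i j hij
    have := congrArg d hij
    simp only [h.depth_iterate] at this
    exact Fin.ext (by omega)
  have := Fintype.card_le_of_injective _ hinj
  rw [Fintype.card_fin, ← Nat.card_eq_fintype_card] at this
  omega

theorem exists_depth_eq (h : IsRooting G s par d) {v : V} {j : ℕ} (hj : j ≤ d v) :
    ∃ u, d u = j := ⟨par^[d v - j] v, by rw [h.depth_iterate]; omega⟩

end IsRooting

/-! ### Sets of depths as numbers -/

theorem testBit_sub_two_pow {S e : ℕ} (h : S.testBit e) (j : ℕ) :
    (S - 2 ^ e).testBit j = (S.testBit j && decide (j ≠ e)) := by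
  have hpos : 0 < 2 ^ e := by positivity
  obtain ⟨a, b, hb, rfl⟩ : ∃ a b, b < 2 ^ e ∧ S = 2 ^ e * a + b :=
    ⟨S / 2 ^ e, S % 2 ^ e, Nat.mod_lt _ hpos, (Nat.div_add_mod _ _).symm⟩
  rw [Nat.testBit_two_pow_mul_add _ hb] at h
  simp only [lt_irrefl, if_false, Nat.sub_self, Nat.testBit_zero, decide_eq_true_eq] at h
  obtain ⟨c, rfl⟩ : ∃ c, a = 2 * c + 1 := ⟨a / 2, by omega⟩
  have : 2 ^ e * (2 * c + 1) + b - 2 ^ e = 2 ^ e * (2 * c) + b := by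
    rw [mul_add]; omega
  rw [this, Nat.testBit_two_pow_mul_add _ hb, Nat.testBit_two_pow_mul_add _ hb]
  split_ifs with hj
  · simp [hj.ne]
  · rcases eq_or_ne j e with rfl | hne
    · simp
    · obtain ⟨i, hi⟩ : ∃ i, j - e = i + 1 := ⟨j - e - 1, by omega⟩
      rw [hi, Nat.testBit_succ, Nat.testBit_succ]
      have h1 : 2 * c / 2 = c := by omega
      have h2 : (2 * c + 1) / 2 = c := by omega
      simp [h1, h2, hne]

theorem two_pow_le_of_testBit {S e : ℕ} (h : S.testBit e) : 2 ^ e ≤ S := Nat.ge_two_pow_of_testBit h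

/-- The number that stands for the set of the depths `1, …, k`. -/
theorem testBit_full (k j : ℕ) : (2 ^ (k + 1) - 2).testBit j = decide (1 ≤ j ∧ j ≤ k) := by
  have h1 : 1 ≤ 2 ^ k := Nat.one_le_two_pow
  have h2 : 2 ^ (k + 1) - 2 = 2 * (2 ^ k - 1) := by rw [pow_succ]; omega
  cases j with
  | zero => simp [h2]
  | succ j =>
    rw [Nat.testBit_succ, h2, Nat.mul_div_cancel_left _ (by norm_num), Nat.testBit_two_pow_sub_one]
    simp

/-! ### The dynamic program -/

/-- `F i S` is the largest number of vertices that are saved by the protection of vertices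
from the `i`-th one in the search order on, which have different depths belonging to the set
`S`; here the set `S` is given by a number less than `K`. -/
structure IsTable (par : V → V) (d : V → ℕ) (ch : V → List V) (s : V) (K : ℕ)
    (F : ℕ → ℕ → ℕ) : Prop where
  last : ∀ S < K, F (Nat.card V) S = 0
  recurrence : ∀ i < Nat.card V, ∀ S < K, F i S = max (F (i + 1) S)
    (if S.testBit (d (dfsOrder ch s i)) then size par (dfsOrder ch s i) +
      F (i + size par (dfsOrder ch s i)) (S - 2 ^ d (dfsOrder ch s i)) else 0)

/-- No choice of vertices with different depths in `S` saves more than the table promises. -/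
theorem IsTable.ncard_le [Finite V] {F : ℕ → ℕ → ℕ} {K : ℕ} (hF : IsTable par d ch s K F)
    (h : IsRooting G s par d) (hch : IsChildren par d ch) {A : Set V}
    (hA : ∀ a ∈ A, ∀ b ∈ A, d a = d b → a = b) {i S : ℕ} (hi : i ≤ Nat.card V) (hS : S < K)
    (hAS : ∀ a ∈ A, a ∈ forest par (dfsStack ch s i) → S.testBit (d a)) :
    {u | ∃ a ∈ A, a ∈ forest par (dfsStack ch s i) ∧ Anc par a u}.ncard ≤ F i S := by
  induction hN : Nat.card V - i using Nat.strong_induction_on generalizing i S with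
  | _ N ih =>
    rcases hi.eq_or_lt with rfl | hi
    · rw [h.dfsStack_card hch, forest_nil]
      simp
    · rw [hF.recurrence i hi S hS]
      set v := dfsOrder ch s i with hv
      -- If `v` is chosen, no other chosen vertex has its depth, and the subtree of `v` can be left.
      by_cases hvA : v ∈ A
      · have hmem : v ∈ forest par (dfsStack ch s i) :=
          (h.forest_dfsStack_succ hch hi).2 (Or.inl rfl)
        have hbit := hAS v hvA hmem
        have hle := h.dfsOrder_add_size_le hch hi
        have hpos := size_pos par v
        have hI := h.indep_dfsStack hch i
        rw [h.dfsStack_eq hch hi, ← hv] at hI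
        refine le_trans ?_ (le_max_right _ _)
        rw [if_pos hbit]
        have hrec := ih (Nat.card V - (i + size par v)) (by rw [← hv] at hle; omega) hle
          (lt_of_le_of_lt (Nat.sub_le S (2 ^ d v)) hS) (fun a haA ha => by
            rw [testBit_sub_two_pow hbit, Bool.and_eq_true, decide_eq_true_eq]
            refine ⟨hAS a haA (h.forest_dfsStack_anti hch (Nat.le_add_right _ _) hle ha),
              fun hda => ?_⟩
            rw [hA a haA v hvA hda] at ha
            exact hI.notMem (Anc.refl _) ha) rfl
        refine le_trans ?_ (Nat.add_le_add_left hrec _)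
        refine le_trans (Set.ncard_le_ncard ?_) (Set.ncard_union_le _ _)
        rintro u ⟨a, haA, ha, hau⟩
        rw [h.dfsStack_eq hch hi, forest_cons] at ha
        rcases ha with ha | ha
        · exact Or.inl (Anc.trans ha hau)
        · exact Or.inr ⟨a, haA, ha, hau⟩
      · refine le_trans ?_ (le_max_left _ _)
        refine le_trans (Set.ncard_le_ncard ?_) (ih (Nat.card V - (i + 1)) (by omega) hi hS
          (fun a haA ha => hAS a haA ((h.forest_dfsStack_succ hch hi).2 (Or.inr ha))) rfl)
        rintro u ⟨a, haA, ha, hau⟩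
        refine ⟨a, haA, ((h.forest_dfsStack_succ hch hi).1 ha).resolve_left ?_, hau⟩
        rintro rfl
        exact hvA haA

/-- No feasible strategy saves more vertices than the table promises. -/
theorem IsTable.ncard_saved_le [Finite V] {F : ℕ → ℕ → ℕ} {k : ℕ}
    (hF : IsTable par d ch s (2 ^ (k + 1)) F) (h : IsRooting G s par d)
    (hch : IsChildren par d ch) {σ : Strategy V} (hσ : IsFeasible G s k σ) :
    (saved G s σ).ncard ≤ F 0 (2 ^ (k + 1) - 2) := by
  obtain ⟨A, hA, hAk, hAs⟩ := h.exists_selection hσ.2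
  have h2 : 0 < 2 ^ (k + 1) := by positivity
  refine le_trans (Set.ncard_le_ncard ?_) (hF.ncard_le h hch hA (Nat.zero_le _)
    (S := 2 ^ (k + 1) - 2) (by omega) fun a ha _ => ?_)
  · intro u hu
    obtain ⟨a, ha, hau⟩ := hAs u hu
    exact ⟨a, ha, ⟨s, by simp [dfsStack], h.anc_root a⟩, hau⟩
  · rw [testBit_full]; simpa using hAk a ha

/-- The state of the traceback through the table `F`, which starts at the entry `F 0 S₀`: the
vertices of `A` have been chosen, and the entry `F i S` remains to be realized.  The subtrees of the
chosen vertices do not meet the part of the tree that is still to be searched, so that the numbers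
of saved vertices add up. -/
structure IsTraced (par : V → V) (d : V → ℕ) (ch : V → List V) (s : V) (F : ℕ → ℕ → ℕ)
    (S₀ i S : ℕ) (A : Set V) : Prop where
  le_card : i ≤ Nat.card V
  le : F 0 S₀ ≤ F i S + {u | ∃ a ∈ A, Anc par a u}.ncard
  sub : ∀ j, S.testBit j → S₀.testBit j
  mem : ∀ a ∈ A, S₀.testBit (d a)
  notMem : ∀ a ∈ A, S.testBit (d a) = false
  disj : ∀ a ∈ A, ∀ u, Anc par a u → u ∉ forest par (dfsStack ch s i)

theorem isTraced_zero (F : ℕ → ℕ → ℕ) (S₀ : ℕ) :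
    IsTraced par d ch s F S₀ 0 S₀ ∅ where
  le_card := Nat.zero_le _
  le := by simp
  sub := fun _ hj => hj
  mem := by simp
  notMem := by simp
  disj := by simp

/-- If skipping the `i`-th vertex does not lower the entry, the traceback skips it. -/
theorem IsTraced.skip [Finite V] {F : ℕ → ℕ → ℕ} {S₀ i S : ℕ} {A : Set V}
    (hT : IsTraced par d ch s F S₀ i S A) (h : IsRooting G s par d) (hch : IsChildren par d ch)
    (hi : i < Nat.card V) (he : F i S = F (i + 1) S) :
    IsTraced par d ch s F S₀ (i + 1) S A where
  le_card := hi
  le := he ▸ hT.le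
  sub := hT.sub
  mem := hT.mem
  notMem := hT.notMem
  disj := fun a ha u hau hu => hT.disj a ha u hau ((h.forest_dfsStack_succ hch hi).2 (Or.inr hu))

theorem IsTable.testBit_of_ne {F : ℕ → ℕ → ℕ} {K i S : ℕ} (hF : IsTable par d ch s K F)
    (hi : i < Nat.card V) (hS : S < K) (hne : F i S ≠ F (i + 1) S) :
    S.testBit (d (dfsOrder ch s i)) := by
  by_contra hb
  rw [hF.recurrence i hi S hS, if_neg hb] at hne
  simp at hne

/-- If skipping the `i`-th vertex lowers the entry, the traceback chooses it. -/
theorem IsTraced.take [Finite V] {F : ℕ → ℕ → ℕ} {K S₀ i S : ℕ} {A : Set V}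
    (hT : IsTraced par d ch s F S₀ i S A) (hF : IsTable par d ch s K F)
    (h : IsRooting G s par d) (hch : IsChildren par d ch)
    (hi : i < Nat.card V) (hS : S < K) (hne : F i S ≠ F (i + 1) S) :
    IsTraced par d ch s F S₀ (i + size par (dfsOrder ch s i)) (S - 2 ^ d (dfsOrder ch s i))
      (insert (dfsOrder ch s i) A) := by
  have hb := hF.testBit_of_ne hi hS hne
  have hle := h.dfsOrder_add_size_le hch hi
  have hr := hF.recurrence i hi S hS
  rw [if_pos hb] at hr
  set v := dfsOrder ch s i with hv
  have hI := h.indep_dfsStack hch i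
  rw [h.dfsStack_eq hch hi, ← hv] at hI
  have hvm : v ∈ forest par (dfsStack ch s i) :=
    (h.forest_dfsStack_succ hch hi).2 (Or.inl rfl)
  refine ⟨hle, ?_, ?_, ?_, ?_, ?_⟩
  · have hset : {u | ∃ a ∈ insert v A, Anc par a u} =
        {u | Anc par v u} ∪ {u | ∃ a ∈ A, Anc par a u} := by
      ext u; simp
    rw [hset, Set.ncard_union_eq]
    · have := hT.le
      rw [← size]
      omega
    · refine Set.disjoint_left.2 ?_
      rintro u hu ⟨a, ha, hau⟩
      exact hT.disj a ha u hau (mem_forest_of_anc hvm hu)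
  · intro j hj
    rw [testBit_sub_two_pow hb, Bool.and_eq_true] at hj
    exact hT.sub j hj.1
  · rintro a (rfl | ha)
    · exact hT.sub _ hb
    · exact hT.mem a ha
  · rintro a (rfl | ha)
    · rw [testBit_sub_two_pow hb]; simp
    · rw [testBit_sub_two_pow hb, hT.notMem a ha]; rfl
  · rintro a (rfl | ha) u hau hu
    · exact hI.notMem hau hu
    · exact hT.disj a ha u hau (h.forest_dfsStack_anti hch (Nat.le_add_right _ _) hle hu)

/-- A list that has the chosen vertices at the places given by their depths, and arbitrary
vertices of the right depths elsewhere, is an optimal strategy once the traceback is complete. -/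
theorem IsTraced.isOptimal [Finite V] {F : ℕ → ℕ → ℕ} {k S : ℕ} {A : Set V}
    (hT : IsTraced par d ch s F (2 ^ (k + 1) - 2) (Nat.card V) S A)
    (hF : IsTable par d ch s (2 ^ (k + 1)) F)
    (h : IsRooting G s par d) (hch : IsChildren par d ch) (hS : S < 2 ^ (k + 1)) {p : List V}
    (hk : p.length ≤ k) (hp : ∀ (i : ℕ) (hi : i < p.length), d p[i] = i + 1)
    (hA : ∀ a ∈ A, p[d a - 1]? = some a) :
    IsOptimal G s k (Strategy.ofList p) ∧
      (saved G s (Strategy.ofList p)).ncard = F 0 (2 ^ (k + 1) - 2) := by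
  have hfeas := h.isFeasible_ofList hk hp
  have hle : F 0 (2 ^ (k + 1) - 2) ≤ (saved G s (Strategy.ofList p)).ncard := by
    have := hT.le
    rw [hF.last S hS, zero_add] at this
    refine this.trans (Set.ncard_le_ncard ?_)
    rintro u ⟨a, ha, hau⟩
    have h1 := hT.mem a ha
    rw [testBit_full, decide_eq_true_eq] at h1
    exact h.mem_saved_of_guard (t := d a - 1) (by omega) (hA a ha) hau
  exact ⟨⟨hfeas, fun τ hτ => (hF.ncard_saved_le h hch hτ).trans hle⟩,
    le_antisymm (hF.ncard_saved_le h hch hfeas) hle⟩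

end Search

end Firefighter

/-! ### The program

The registers `0`, `2`–`8`, `24`–`28`, `30` and `31` are constant after the setup, see `Env`; the first
of them hold `n` and `k`.  Register `9` is the height of the stack, `10` is the counter of the main
loop of each part, `11` the current vertex of the search, `13` and `14` delimit its list of
neighbours, `18` is the largest depth met so far, and `23` is scratch space for addresses. In the
table and in the traceback `12` holds the set of the depths. -/

namespace Firefighter

open RAM Instr

namespace Prog

/-- `r_a := (field with base address r_f of the record r_b)`; register `23` is overwritten. -/
def get (f a b : ℕ) : Cmd := .op (mul 23 b 5) ;; .op (add 23 23 f) ;; .op (load a 23)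

/-- `(field with base address r_f of the record r_b) := r_a`; register `23` is overwritten. -/
def set (f a b : ℕ) : Cmd := .op (mul 23 b 5) ;; .op (add 23 23 f) ;; .op (store 23 a)

/-- Loads constants and addresses, and computes `2 ^ (k + 1)` in register `8`. -/
def setup : Cmd :=
  .op (const 3 1) ;; .op (const 5 8) ;; .op (const 31 2) ;; .op (load 4 0) ;;
  .op (mul 6 0 5) ;; .op (add 6 6 4) ;; .op (add 7 6 0) ;;
  .op (add 24 4 3) ;; .op (add 25 24 3) ;; .op (add 26 25 3) ;; .op (add 27 26 3) ;;
  .op (add 28 27 3) ;; .op (const 8 2) ;;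
  .whileLt 10 2 (.op (add 8 8 8) ;; .op (add 10 10 3))

/-- Pushes the vertex in register `15` as a child of the vertex in register `11`. -/
def push : Cmd :=
  set 4 11 15 ;; set 24 20 15 ;; set 25 21 15 ;; set 28 15 9 ;; .op (add 9 9 3)

/-- Runs through the neighbours of the vertex in register `11`. -/
def expand : Cmd :=
  .whileLt 13 14 (.op (load 15 13) ;; .ifEq 15 19 (.op (copy 15 15)) push ;; .op (add 13 13 3))

/-- Takes the next vertex from the stack to register `11` and records it. -/
def pop : Cmd :=
  .op (sub 9 9 3) ;; get 28 11 9 ;; set 27 11 10 ;; set 26 3 11 ;; get 4 19 11 ;;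
  get 24 20 11 ;; .op (add 22 6 20) ;; .op (store 22 11) ;;
  .ifLt 18 20 (.op (copy 18 20)) (.op (copy 18 18)) ;;
  .op (add 20 20 3) ;; get 25 21 11 ;;
  .ifLt 21 8 (.op (add 21 21 21)) (.op (copy 21 21)) ;;
  .op (load 13 11) ;; .op (add 14 11 3) ;; .op (load 14 14)

/-- The depth-first search. -/
def search : Cmd :=
  set 4 1 1 ;; set 24 30 1 ;; set 25 3 1 ;; set 28 1 30 ;; .op (copy 9 3) ;; .op (copy 10 30) ;;
  .op (copy 18 30) ;;
  .whileLt 10 0 (pop ;; expand ;; .op (add 10 10 3))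

/-- The sizes of the subtrees: in reverse search order, the size of each vertex but the root is
added to that of its parent. -/
def sizes : Cmd :=
  .whileLt 3 10 (.op (sub 10 10 3) ;; get 27 11 10 ;; get 4 12 11 ;; get 26 13 11 ;;
    get 26 14 12 ;; .op (add 14 14 13) ;; set 26 14 12)

/-- The table of the dynamic program, from its last entry to its first one.  The entry `F i S` is
the `(i * 2 ^ (k + 1) + S)`-th one, so that one loop runs through all of them. -/
def table : Cmd :=
  .op (mul 10 0 8) ;;
  .whileLt 30 10 (.op (sub 10 10 3) ;; .op (div 11 10 8) ;; .op (mul 12 11 8) ;;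
    .op (sub 12 10 12) ;; get 27 13 11 ;; get 26 14 13 ;; get 25 15 13 ;; .op (add 16 7 10) ;;
    .op (add 17 16 8) ;; .op (load 17 17) ;;
    .op (div 19 12 15) ;; .op (div 20 19 31) ;; .op (add 20 20 20) ;;
    .ifLt 20 19 (.op (mul 21 14 8) ;; .op (add 21 21 16) ;; .op (sub 21 21 15) ;;
      .op (load 21 21) ;; .op (add 21 21 14) ;;
      .ifLt 17 21 (.op (copy 17 21)) (.op (copy 17 17))) (.op (copy 17 17)) ;;
    .op (store 16 17))

/-- The traceback through the table; chosen vertices overwrite the list for the strategy. -/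
def trace : Cmd :=
  .op (sub 12 8 31) ;; .op (copy 10 30) ;;
  .whileLt 10 0 (.op (mul 16 10 8) ;; .op (add 16 16 12) ;; .op (add 16 16 7) ;;
    .op (load 17 16) ;; .op (add 16 16 8) ;; .op (load 19 16) ;;
    .ifEq 17 19 (.op (add 10 10 3)) (get 27 13 10 ;; get 26 14 13 ;; get 25 15 13 ;;
      get 24 20 13 ;; .op (add 20 20 6) ;; .op (store 20 13) ;; .op (sub 12 12 15) ;;
      .op (add 10 10 14)))

/-- Writes the output registers.  Depth `0` has a place in the list for the strategy, which
therefore starts one cell later. -/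
def finish : Cmd :=
  .ifLt 2 18 (.op (copy 0 2)) (.op (copy 0 18)) ;; .op (add 16 7 8) ;; .op (sub 16 16 31) ;;
  .op (load 2 16) ;; .op (add 1 6 3)

/-- The whole program. -/
def main : Cmd := setup ;; search ;; sizes ;; table ;; trace ;; finish

end Prog

theorem Does.get {B f a b x j : ℕ} {r m : ℕ → ℕ} {Q : (ℕ → ℕ) → (ℕ → ℕ) → Prop}
    (h5 : r 5 = 8) (hf : r f = x) (hf' : f ≠ 23) (hb : r b = j) (hB : x + 8 * j ≤ B)
    (h : Q (Function.update (Function.update r 23 (x + 8 * j)) a (m (x + 8 * j))) m) :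
    Does B (Prog.get f a b) 3 r m Q := by
  refine Does.seq (T₁ := 1) (T₂ := 2) (Does.mul (by rw [hb, h5]; omega) ?_)
  refine Does.seq (T₁ := 1) (T₂ := 1)
    (Does.add (by simp [hf', hf, hb, h5]; omega) (Does.load ?_))
  have : 8 * j + x = x + 8 * j := add_comm _ _
  simpa [hf', hf, hb, h5, mul_comm j, this] using h

theorem Does.set {B f a b x y j : ℕ} {r m : ℕ → ℕ} {Q : (ℕ → ℕ) → (ℕ → ℕ) → Prop}
    (h5 : r 5 = 8) (hf : r f = x) (hf' : f ≠ 23) (ha : r a = y) (ha' : a ≠ 23) (hb : r b = j)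
    (hB : x + 8 * j ≤ B)
    (h : Q (Function.update r 23 (x + 8 * j)) (Function.update m (x + 8 * j) y)) :
    Does B (Prog.set f a b) 3 r m Q := by
  refine Does.seq (T₁ := 1) (T₂ := 2) (Does.mul (by rw [hb, h5]; omega) ?_)
  refine Does.seq (T₁ := 1) (T₂ := 1)
    (Does.add (by simp [hf', hf, hb, h5]; omega) (Does.store ?_))
  have : 8 * j + x = x + 8 * j := add_comm _ _
  simpa [hf', hf, ha, ha', hb, h5, mul_comm j, this] using h

/-- The registers that are constant after the setup.  The input array ends before the address
`M`; then come `n` records of `8` cells, a list of `n` cells for the strategy, which is indexed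
by the depths, and the table of the dynamic program.  The fields of the record `v` are the
parent of `v`, its depth `d v`, the number `min (2 ^ d v) (2 ^ (k + 1))`, the size of its subtree,
the `v`-th vertex of the search order, and the `v`-th vertex of the stack.  Two cells of each record
are unused. -/
structure Env (n k M : ℕ) (r : ℕ → ℕ) : Prop where
  r0 : r 0 = n
  r2 : r 2 = k
  r3 : r 3 = 1
  r4 : r 4 = M
  r5 : r 5 = 8
  r6 : r 6 = M + 8 * n
  r7 : r 7 = M + 9 * n
  r8 : r 8 = 2 ^ (k + 1)
  r24 : r 24 = M + 1
  r25 : r 25 = M + 2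
  r26 : r 26 = M + 3
  r27 : r 27 = M + 4
  r28 : r 28 = M + 5
  r30 : r 30 = 0
  r31 : r 31 = 2

theorem Env.update {n k M : ℕ} {r : ℕ → ℕ} (h : Env n k M r) {a v : ℕ} (ha : 9 ≤ a ∧ a < 24) :
    Env n k M (Function.update r a v) := by
  obtain ⟨h0, h2, h3, h4, h5, h6, h7, h8, h24, h25, h26, h27, h28, h30, h31⟩ := h
  constructor <;> rw [Function.update_of_ne (by omega)] <;> assumption

end Firefighter

namespace Firefighter

open RAM Instr

/-! ### Correctness of the search -/

section Correctness

variable {n k M B i : ℕ} {G : SimpleGraph (Fin n)} {s : Fin n} {par : Fin n → Fin n}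
  {d : Fin n → ℕ} {ch : Fin n → List (Fin n)} {inp r m : ℕ → ℕ}

/-- The first three fields of the record `v` are right.  The power `2 ^ d v` is cut off at
`2 ^ (k + 1)`: this keeps the words short, and for `S < 2 ^ (k + 1)` the quotient of `S` by the field
is even if `d v` exceeds `k`, as it is by `2 ^ d v`. -/
structure IsRecord (k M : ℕ) (par : Fin n → Fin n) (d : Fin n → ℕ) (m : ℕ → ℕ) (v : Fin n) :
    Prop where
  par : m (M + 8 * v) = par v
  depth : m (M + 1 + 8 * v) = d v
  weight : m (M + 2 + 8 * v) = min (2 ^ d v) (2 ^ (k + 1))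

/-- The state of the search after `i` vertices have been taken from the stack, when the stack
contains the vertices of `L`, the last one on top. -/
structure SearchInv (k M : ℕ) (s : Fin n) (par : Fin n → Fin n) (d : Fin n → ℕ)
    (ch : Fin n → List (Fin n)) (inp : ℕ → ℕ) (i : ℕ) (L : List (Fin n)) (r m : ℕ → ℕ) :
    Prop where
  env : Env n k M r
  height : r 9 = L.length
  input : ∀ a < M, m a = inp a
  zero : ∀ a, M + 9 * n ≤ a → m a = 0
  stack : ∀ (j : ℕ) (hj : j < L.length), m (M + 5 + 8 * j) = L[j]
  record : ∀ v, (v ∈ L ∨ ∃ j < i, dfsOrder ch s j = v) → IsRecord k M par d m v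
  order : ∀ j < i, m (M + 4 + 8 * j) = (dfsOrder ch s j).val
  one : ∀ j < i, m (M + 3 + 8 * (dfsOrder ch s j).val) = 1
  filler : ∀ j < i, ∃ x : Fin n, m (M + 8 * n + d (dfsOrder ch s j)) = x ∧
    d x = d (dfsOrder ch s j)
  le_max : ∀ j < i, d (dfsOrder ch s j) ≤ r 18
  max_eq : ∃ v, d v = r 18

theorem does_push {L : List (Fin n)} {u : Fin n} (hI : SearchInv k M s par d ch inp i L r m)
    (hin : i ≤ n) (hd : ∀ v, d v < n) (hL : L.length < n) (h11 : r 11 = par u) (h15 : r 15 = u)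
    (h20 : r 20 = d u) (h21 : r 21 = min (2 ^ d u) (2 ^ (k + 1))) (hB : M + 9 * n + 5 ≤ B) :
    Does B Prog.push 13 r m fun r' m' => SearchInv k M s par d ch inp i (L ++ [u]) r' m' ∧
      ∀ a, a ≠ 9 → a ≠ 23 → r' a = r a := by
  have hu := u.isLt
  have E := hI.env
  have hs := hI.height
  refine Does.seq (T₁ := 3) (T₂ := 10) (Does.set (x := M) (j := u) (y := par u) E.r5 E.r4
    (by norm_num) h11 (by norm_num) h15 (by omega) ?_)
  refine Does.seq (T₁ := 3) (T₂ := 7) (Does.set (x := M + 1) (j := u) (y := d u) (by simp [E.r5])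
    (by simp [E.r24]) (by norm_num) (by simp [h20]) (by norm_num) (by simp [h15]) (by omega) ?_)
  refine Does.seq (T₁ := 3) (T₂ := 4) (Does.set (x := M + 2) (j := u)
    (y := min (2 ^ d u) (2 ^ (k + 1))) (by simp [E.r5])
    (by simp [E.r25]) (by norm_num) (by simp [h21]) (by norm_num) (by simp [h15]) (by omega) ?_)
  refine Does.seq (T₁ := 3) (T₂ := 1) (Does.set (x := M + 5) (j := L.length)
    (y := u) (by simp [E.r5])
    (by simp [E.r28]) (by norm_num) (by simp [h15]) (by norm_num) (by simp [hs]) (by omega) ?_)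
  refine Does.add (by simp [hs, E.r3]; omega) ⟨?_, ?_⟩
  · have hmem : ∀ a, a ≠ M + 8 * u → a ≠ M + 1 + 8 * u → a ≠ M + 2 + 8 * u →
        a ≠ M + 5 + 8 * L.length → Function.update (Function.update (Function.update
          (Function.update m (M + 8 * ↑u) ↑(par u)) (M + 1 + 8 * ↑u) (d u)) (M + 2 + 8 * ↑u)
          (min (2 ^ d u) (2 ^ (k + 1)))) (M + 5 + 8 * L.length) ↑u a = m a := by
      intro a h1 h2 h3 h4
      simp [h1, h2, h3, h4]
    refine ⟨?_, ?_, ?_, ?_, ?_, ?_, ?_, ?_, ?_, ?_, ?_⟩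
    · repeat (refine Env.update ?_ (by norm_num))
      exact E
    · simp [hs, E.r3]
    · intro a ha
      rw [hmem a (by omega) (by omega) (by omega) (by omega)]
      exact hI.input a ha
    · intro a ha
      rw [hmem a (by omega) (by omega) (by omega) (by omega)]
      exact hI.zero a ha
    · intro j hj
      rcases eq_or_ne j L.length with rfl | hne
      · simp
      · have hjL : j < L.length := by simp at hj; omega
        rw [hmem _ (by omega) (by omega) (by omega) (by omega), hI.stack j hjL,
          List.getElem_append_left hjL]
    · intro v hv
      by_cases hvu : v = u
      · subst hvu
        constructor
        · rw [Function.update_of_ne (by omega), Function.update_of_ne (by omega),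
            Function.update_of_ne (by omega), Function.update_self]
        · rw [Function.update_of_ne (by omega), Function.update_of_ne (by omega),
            Function.update_self]
        · rw [Function.update_of_ne (by omega), Function.update_self]
      · have hvu' : (v : ℕ) ≠ u := fun h => hvu (Fin.ext h)
        have hR := hI.record v (by
          rcases hv with hv | hv
          · left; simpa [hvu] using hv
          · exact Or.inr hv)
        constructor
        · rw [hmem _ (by omega) (by omega) (by omega) (by omega)]; exact hR.par
        · rw [hmem _ (by omega) (by omega) (by omega) (by omega)]; exact hR.depth
        · rw [hmem _ (by omega) (by omega) (by omega) (by omega)]; exact hR.weight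
    · intro j hj
      rw [hmem _ (by omega) (by omega) (by omega) (by omega)]; exact hI.order j hj
    · intro j hj
      rw [hmem _ (by omega) (by omega) (by omega) (by omega)]; exact hI.one j hj
    · intro j hj
      have := hd (dfsOrder ch s j)
      rw [hmem _ (by omega) (by omega) (by omega) (by omega)]; exact hI.filler j hj
    · intro j hj
      simpa using hI.le_max j hj
    · simpa using hI.max_eq
  · intro a h9 h23
    simp [h9, h23]

/-- Apart from the constants, only the registers `9` and `18` belong to the state. -/
theorem SearchInv.of_reg {L : List (Fin n)} {r' : ℕ → ℕ}
    (hI : SearchInv k M s par d ch inp i L r m) (hE : Env n k M r') (h9 : r' 9 = r 9)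
    (h18 : r' 18 = r 18) : SearchInv k M s par d ch inp i L r' m := by
  obtain ⟨_, h1, h2, h3, h4, h5, h6, h7, h8, h10, h11⟩ := hI
  exact ⟨hE, h9.trans h1, h2, h3, h4, h5, h6, h7, h8, by rwa [h18], by rwa [h18]⟩

/-- The neighbours `N` of the vertex `v`, except for its parent, are pushed.  Their records are
written with values that depend only on the tree, so no visited vertex has to be recognized. -/
theorem does_expand {L : List (Fin n)} {N : List (Fin n)} {v : Fin n} {a₀ : ℕ}
    (hI : SearchInv k M s par d ch inp i L r m) (hin : i ≤ n) (hd : ∀ v, d v < n)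
    (hN : ∀ (q : ℕ) (hq : q < N.length), inp (a₀ + q) = N[q]) (hM : a₀ + N.length ≤ M)
    (hpar : ∀ u ∈ N, u ≠ par v → par u = v ∧ d u = d v + 1)
    (hL : (L ++ N.filter (· ≠ par v)).length ≤ n) (h11 : r 11 = v) (h13 : r 13 = a₀)
    (h14 : r 14 = a₀ + N.length) (h19 : r 19 = par v) (h20 : r 20 = d v + 1)
    (h21 : r 21 = min (2 ^ (d v + 1)) (2 ^ (k + 1))) (hB : M + 9 * n + 5 ≤ B) :
    Does B Prog.expand (18 * N.length + 2) r m fun r' m' =>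
      SearchInv k M s par d ch inp i (L ++ N.filter (· ≠ par v)) r' m' ∧ r' 10 = r 10 := by
  refine Does.whileLt (I := fun p r' m' => ∃ q ≤ N.length, p = 18 * (N.length - q) ∧
    SearchInv k M s par d ch inp i (L ++ (N.take q).filter (· ≠ par v)) r' m' ∧
    r' 13 = a₀ + q ∧ ∀ a, a ≠ 9 → a ≠ 13 → a ≠ 15 → a ≠ 23 → r' a = r a) _
    ⟨0, Nat.zero_le _, rfl, by simpa using hI, by simpa using h13, fun _ _ _ _ _ => rfl⟩ ?_ ?_
  · rintro p r' m' ⟨q, hq, rfl, hI', h13', hfr⟩ hlt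
    rw [h13', hfr 14 (by norm_num) (by norm_num) (by norm_num) (by norm_num), h14] at hlt
    have hq : q < N.length := by omega
    have E := hI'.env
    have hu : m' (r' 13) = N[q] := by
      rw [h13', hI'.input _ (by omega), hN q hq]
    have htake : N.take (q + 1) = N.take q ++ [N[q]] := List.take_succ_eq_append_getElem hq
    refine ⟨1 + (15 + 1), by omega, Does.seq (Does.load ?_)⟩
    rw [hu]
    refine Does.seq (Does.ifEq (T := 13) (fun he => ?_) (fun hne => ?_))
    · have he : N[q] = par v := by
        apply Fin.ext
        simpa [hfr 19 (by norm_num) (by norm_num) (by norm_num) (by norm_num), h19] using he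
      refine Does.mono (Does.copy ?_) (by norm_num) fun _ _ h => h
      refine Does.add (by simp [h13', E.r3]; omega) ?_
      refine ⟨18 * (N.length - (q + 1)), by omega, q + 1, hq, rfl, ?_, ?_, ?_⟩
      · rw [htake, List.filter_append, List.filter_singleton]
        simp only [he, ne_eq, not_true_eq_false, decide_false, cond_false, List.append_nil]
        refine hI'.of_reg ?_ (by simp) (by simp)
        repeat (refine Env.update ?_ (by norm_num))
        exact E
      · simp [h13', E.r3]; omega
      · intro a h9 h13 h15 h23
        simp [h13, h15, hfr a h9 h13 h15 h23]
    · have hne : N[q] ≠ par v := by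
        intro he
        apply hne
        simp [hfr 19 (by norm_num) (by norm_num) (by norm_num) (by norm_num), h19, he]
      have hp := hpar _ (List.getElem_mem hq) hne
      have hfil : N.take q ++ [N[q]] <+: N := by
        rw [← htake]; exact List.take_prefix _ _
      have hlen := ((hfil.filter fun x => decide (x ≠ par v)).length_le)
      rw [List.filter_append, List.filter_singleton] at hlen
      simp only [hne, ne_eq, not_false_eq_true, decide_true, cond_true, List.length_append,
        List.length_singleton] at hlen hL
      have hI2 : SearchInv k M s par d ch inp i (L ++ (N.take q).filter (· ≠ par v))
          (Function.update r' 15 (N[q] : ℕ)) m' :=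
        hI'.of_reg (E.update (by norm_num)) (by simp) (by simp)
      refine Does.mono (does_push hI2 hin hd (u := N[q]) ?_ ?_ ?_ ?_ ?_ hB) le_rfl ?_
      · simp only [List.length_append, ne_eq]; omega
      · simp [hfr 11, h11, hp.1]
      · simp
      · simp [hfr 20, h20, hp.2]
      · simp [hfr 21, h21, hp.2]
      · rintro r2 m2 ⟨hI3, hfr2⟩
        have h13 : r2 13 = a₀ + q := by rw [hfr2 13 (by norm_num) (by norm_num)]; simpa using h13'
        have E2 := hI3.env
        refine Does.add (by rw [h13, E2.r3]; omega) ?_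
        refine ⟨18 * (N.length - (q + 1)), by omega, q + 1, hq, rfl, ?_, ?_, ?_⟩
        · rw [htake, List.filter_append, List.filter_singleton]
          simp only [hne, ne_eq, not_false_eq_true, decide_true, cond_true]
          rw [← List.append_assoc]
          exact hI3.of_reg (E2.update (by norm_num)) (by simp) (by simp)
        · simp [h13, E2.r3]; omega
        · intro a h9 h13 h15 h23
          simp [h13, h15, hfr a h9 h13 h15 h23, hfr2 a h9 h23]
  · rintro p r' m' ⟨q, hq, rfl, hI', h13', hfr⟩ hge
    rw [h13', hfr 14 (by norm_num) (by norm_num) (by norm_num) (by norm_num), h14] at hge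
    obtain rfl : q = N.length := by omega
    rw [List.take_length] at hI'
    exact ⟨hI', hfr 10 (by norm_num) (by norm_num) (by norm_num) (by norm_num)⟩

/-- The vertex `v` on top of the stack becomes the `i`-th one of the search order and is recorded
as a vertex of its depth in the list for the strategy.  The registers are prepared for the loop
through its neighbours. -/
theorem does_pop {L : List (Fin n)} {v : Fin n}
    (hI : SearchInv k M s par d ch inp i (L ++ [v]) r m) (hin : i < n) (hd : ∀ v, d v < n)
    (hv : dfsOrder ch s i = v) (hLn : L.length < n)
    (hM : n < M) (h10 : r 10 = i) (hB : M + 9 * n + 5 ≤ B) (hK : 2 ^ (k + 1) * 2 ≤ B) :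
    Does B Prog.pop 31 r m fun r' m' => SearchInv k M s par d ch inp (i + 1) L r' m' ∧
      r' 10 = i ∧ r' 11 = v ∧ r' 13 = inp v ∧ r' 14 = inp (v + 1) ∧ r' 19 = par v ∧
      r' 20 = d v + 1 ∧ r' 21 = min (2 ^ (d v + 1)) (2 ^ (k + 1)) := by
  have E := hI.env
  have hs : r 9 = L.length + 1 := by simpa using hI.height
  have hvn := v.isLt
  have hR := hI.record v (Or.inl (by simp))
  have hst : m (M + 5 + 8 * L.length) = v := by
    rw [hI.stack L.length (by simp)]; simp
  have hdv := hd v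
  refine Does.seq (T₁ := 1) (T₂ := 30) (Does.sub ?_)
  refine Does.seq (T₁ := 3) (T₂ := 27) (Does.get (x := M + 5) (j := L.length) (by simp [E.r5])
    (by simp [E.r28]) (by norm_num) (by simp [hs, E.r3]) (by omega) ?_)
  rw [hst]
  refine Does.seq (T₁ := 3) (T₂ := 24) (Does.set (x := M + 4) (y := v) (j := i) (by simp [E.r5])
    (by simp [E.r27]) (by norm_num) (by simp) (by norm_num) (by simp [h10]) (by omega) ?_)
  refine Does.seq (T₁ := 3) (T₂ := 21) (Does.set (x := M + 3) (y := 1) (j := v) (by simp [E.r5])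
    (by simp [E.r26]) (by norm_num) (by simp [E.r3]) (by norm_num) (by simp) (by omega) ?_)
  refine Does.seq (T₁ := 3) (T₂ := 18) (Does.get (x := M) (j := v) (by simp [E.r5])
    (by simp [E.r4]) (by norm_num) (by simp) (by omega) ?_)
  refine Does.seq (T₁ := 3) (T₂ := 15) (Does.get (x := M + 1) (j := v) (by simp [E.r5])
    (by simp [E.r24]) (by norm_num) (by simp) (by omega) ?_)
  rw [Function.update_of_ne (by omega), Function.update_of_ne (by omega), hR.par,
    Function.update_of_ne (by omega), Function.update_of_ne (by omega), hR.depth]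
  refine Does.seq (T₁ := 1) (T₂ := 14) (Does.add (by simp [E.r6]; omega) ?_)
  refine Does.seq (T₁ := 1) (T₂ := 13) (Does.store ?_)
  refine Does.seq (T₁ := 3) (T₂ := 10) (Does.mono
    (Q := fun r' m' => Env n k M r' ∧ r' 9 = L.length ∧ r' 10 = i ∧ r' 11 = v ∧ r' 19 = par v ∧
      r' 20 = d v ∧ r' 18 = max (r 18) (d v) ∧ m' = Function.update (Function.update
        (Function.update m (M + 4 + 8 * i) v) (M + 3 + 8 * v) 1) (M + 8 * n + d v) v)
    (Does.ifLt (T := 1) (fun hlt => Does.copy ?_) (fun hge => Does.copy ?_)) le_rfl ?_)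
  · refine ⟨?_, ?_⟩
    · repeat (refine Env.update ?_ (by norm_num))
      exact E
    · simp [hs, E.r3, h10, E.r6] at hlt ⊢
      omega
  · refine ⟨?_, ?_⟩
    · repeat (refine Env.update ?_ (by norm_num))
      exact E
    · simp [hs, E.r3, h10, E.r6] at hge ⊢
      omega
  rintro r1 m1 ⟨E, h9, h10, h11, h19, h20, h18, rfl⟩
  have hmem : ∀ a, a ≠ M + 4 + 8 * i → a ≠ M + 3 + 8 * v → a ≠ M + 8 * n + d v →
      Function.update (Function.update (Function.update m (M + 4 + 8 * i) v.val)
        (M + 3 + 8 * v) 1) (M + 8 * n + d v) v a = m a := by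
    intro a h1 h2 h3
    simp [h1, h2, h3]
  refine Does.seq (T₁ := 1) (T₂ := 9) (Does.add (by simp [h20, E.r3]; omega) ?_)
  refine Does.seq (T₁ := 3) (T₂ := 6) (Does.get (x := M + 2) (j := v) (by simp [E.r5])
    (by simp [E.r25]) (by norm_num) (by simp [h11]) (by omega) ?_)
  rw [hmem _ (by omega) (by omega) (by omega), hR.weight]
  refine Does.seq (T₁ := 3) (T₂ := 3) (Does.mono
    (Q := fun r' m' => Env n k M r' ∧ r' 9 = L.length ∧ r' 10 = i ∧ r' 11 = v ∧ r' 19 = par v ∧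
      r' 20 = d v + 1 ∧ r' 18 = max (r 18) (d v) ∧
      r' 21 = min (2 ^ (d v + 1)) (2 ^ (k + 1)) ∧ m' = Function.update (Function.update
        (Function.update m (M + 4 + 8 * i) v) (M + 3 + 8 * v) 1) (M + 8 * n + d v) v)
    (Does.ifLt (T := 1) (fun hlt => Does.add ?_ ?_) (fun hge => Does.copy ?_)) le_rfl ?_)
  · simp [E.r8] at hlt ⊢
    omega
  · refine ⟨?_, ?_⟩
    · repeat (refine Env.update ?_ (by norm_num))
      exact E
    · have hlt : 2 ^ d v < 2 ^ (k + 1) := by simpa [E.r8] using hlt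
      have h2 : 2 ^ (d v + 1) ≤ 2 ^ (k + 1) :=
        Nat.pow_le_pow_right (by norm_num) ((Nat.pow_lt_pow_iff_right (by norm_num)).1 hlt)
      simp only [ne_eq, Nat.reduceEqDiff, not_false_eq_true, Function.update_of_ne,
        Function.update_self, h9, h10, h11, h19, h20, h18, E.r3, true_and, and_true]
      rw [min_eq_left h2, min_eq_left hlt.le, pow_succ]
      omega
  · refine ⟨?_, ?_⟩
    · repeat (refine Env.update ?_ (by norm_num))
      exact E
    · have hge : 2 ^ (k + 1) ≤ 2 ^ d v := by simpa [E.r8] using hge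
      have h2 : 2 ^ (k + 1) ≤ 2 ^ (d v + 1) := hge.trans
        (Nat.pow_le_pow_right (by norm_num) (Nat.le_succ _))
      simp [h9, h10, h11, h19, h20, h18, E.r3, min_eq_right h2, min_eq_right hge]
  rintro r2 m2 ⟨E, h9, h10, h11, h19, h20, h18, h21, rfl⟩
  refine Does.seq (T₁ := 1) (T₂ := 2) (Does.load ?_)
  rw [h11, hmem _ (by omega) (by omega) (by omega), hI.input _ (by omega)]
  refine Does.seq (T₁ := 1) (T₂ := 1) (Does.add (by simp [h11, E.r3]; omega) (Does.load ?_))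
  simp only [ne_eq, Nat.reduceEqDiff, not_false_eq_true, Function.update_of_ne,
        Function.update_self, h11, E.r3]
  rw [hmem _ (by omega) (by omega) (by omega), hI.input _ (by omega)]
  refine ⟨⟨?_, ?_, ?_, ?_, ?_, ?_, ?_, ?_, ?_, ?_, ?_⟩, ?_⟩
  · repeat (refine Env.update ?_ (by norm_num))
    exact E
  · simp [h9]
  · intro a ha
    rw [hmem _ (by omega) (by omega) (by omega)]; exact hI.input a ha
  · intro a ha
    rw [hmem _ (by omega) (by omega) (by omega)]; exact hI.zero a ha
  · intro j hj
    rw [hmem _ (by omega) (by omega) (by omega), hI.stack j (by simp; omega),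
      List.getElem_append_left hj]
  · intro x hx
    have hR := hI.record x (by
      rcases hx with hx | ⟨j, hj, hx⟩
      · exact Or.inl (by simp [hx])
      · rcases (Nat.lt_succ_iff.1 hj).eq_or_lt with rfl | hj
        · exact Or.inl (by simp [← hx, hv])
        · exact Or.inr ⟨j, hj, hx⟩)
    have hxn := x.isLt
    constructor
    · rw [hmem _ (by omega) (by omega) (by omega)]; exact hR.par
    · rw [hmem _ (by omega) (by omega) (by omega)]; exact hR.depth
    · rw [hmem _ (by omega) (by omega) (by omega)]; exact hR.weight
  · intro j hj
    rcases (Nat.lt_succ_iff.1 hj).eq_or_lt with rfl | hj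
    · rw [Function.update_of_ne (by omega), Function.update_of_ne (by omega),
        Function.update_self, hv]
    · rw [hmem _ (by omega) (by omega) (by omega)]; exact hI.order j hj
  · intro j hj
    by_cases hjv : dfsOrder ch s j = v
    · rw [hjv, Function.update_of_ne (by omega), Function.update_self]
    · have hjv' : (dfsOrder ch s j).val ≠ v := fun h => hjv (Fin.ext h)
      have hjn := (dfsOrder ch s j).isLt
      have hji : j < i := by
        rcases (Nat.lt_succ_iff.1 hj).eq_or_lt with rfl | hj
        · exact absurd hv hjv
        · exact hj
      rw [hmem _ (by omega) (by omega) (by omega)]; exact hI.one j hji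
  · intro j hj
    by_cases hjv : d (dfsOrder ch s j) = d v
    · rw [hjv]
      exact ⟨v, by rw [Function.update_self], rfl⟩
    · have hji : j < i := by
        rcases (Nat.lt_succ_iff.1 hj).eq_or_lt with rfl | hj
        · exact absurd (by rw [hv]) hjv
        · exact hj
      rw [hmem _ (by omega) (by omega) (by omega)]; exact hI.filler j hji
  · intro j hj
    have : Function.update (Function.update (Function.update r2 13 (inp v)) 14 (v + 1)) 14
        (inp (v + 1)) 18 = r2 18 := by simp
    rw [this, h18]
    rcases (Nat.lt_succ_iff.1 hj).eq_or_lt with rfl | hj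
    · rw [hv]; exact le_max_right _ _
    · exact (hI.le_max j hj).trans (le_max_left _ _)
  · have : Function.update (Function.update (Function.update r2 13 (inp v)) 14 (v + 1)) 14
        (inp (v + 1)) 18 = r2 18 := by simp
    rw [this, h18]
    rcases le_total (r 18) (d v) with hle | hle
    · exact ⟨v, by rw [max_eq_right hle]⟩
    · obtain ⟨x, hx⟩ := hI.max_eq
      exact ⟨x, by rw [max_eq_left hle, hx]⟩
  · simp [h10, h19, h20, h21]

end Correctness

end Firefighter

namespace Firefighter

open RAM Instr

section Correctness

variable {n k M B i : ℕ} {G : SimpleGraph (Fin n)} {s : Fin n} {par : Fin n → Fin n}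
  {d : Fin n → ℕ} {adj ch : Fin n → List (Fin n)} {inp r m : ℕ → ℕ}

/-- The function `inp` contains the adjacency lists `adj`, below the address `M`. -/
structure IsInput (adj : Fin n → List (Fin n)) (M : ℕ) (inp : ℕ → ℕ) : Prop where
  lt : n < M
  next : ∀ v : Fin n, inp (v + 1) = inp v + (adj v).length
  le : ∀ v : Fin n, inp v + (adj v).length ≤ M
  entry : ∀ (v : Fin n) (q : ℕ) (hq : q < (adj v).length), inp (inp v + q) = (adj v)[q]

/-- The children of `v` in the order in which the search takes them from the stack. -/
def children (par : Fin n → Fin n) (adj : Fin n → List (Fin n)) (v : Fin n) : List (Fin n) :=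
  ((adj v).filter (· ≠ par v)).reverse

theorem IsRooting.of_mem_adj (h : IsRooting G s par d) (hadj : IsAdjacencyList G adj)
    {u v : Fin n} : u ∈ adj v ∧ u ≠ par v ↔ par u = v ∧ d u = d v + 1 := by
  rw [(hadj v).2, h.adj_iff]
  constructor
  · rintro ⟨h1 | h1, h2⟩
    · exact h1
    · exact absurd h1.1.symm h2
  · intro h1
    refine ⟨Or.inl h1, ?_⟩
    rintro rfl
    have := h.depth_par v
    omega

theorem IsRooting.isChildren_children (h : IsRooting G s par d) (hadj : IsAdjacencyList G adj) :
    IsChildren par d (children par adj) := by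
  intro v
  refine ⟨List.nodup_reverse.2 ((hadj v).1.filter _), fun c => ?_⟩
  rw [← h.of_mem_adj hadj]
  simp [children]

theorem length_adj_le (hadj : IsAdjacencyList G adj) (v : Fin n) :
    (adj v).length ≤ (children par adj v).length + 1 := by
  have : adj v ⊆ par v :: children par adj v := by
    intro u hu
    by_cases hp : u = par v
    · simp [hp]
    · simp [children, hu, hp]
  simpa using (List.subperm_of_subset (hadj v).1 this).length_le

/-- A round of the search takes a vertex `v` and at most `18 * (adj v).length + 34` steps, and `adj v`
has at most one element that is not pushed.  So the remaining time
`72 * (n - i) - 18 * (height of the stack)` suffices. -/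
theorem does_search (h : IsRooting G s par d) (hadj : IsAdjacencyList G adj)
    (hinp : IsInput adj M inp) (E : Env n k M r) (h1 : r 1 = s) (hm : ∀ a < M, m a = inp a)
    (hz : ∀ a, M + 9 * n ≤ a → m a = 0) (hB : M + 9 * n + 5 ≤ B) (hK : 2 ^ (k + 1) * 2 ≤ B) :
    Does B Prog.search (72 * n + 17) r m fun r' m' =>
      SearchInv k M s par d (children par adj) inp n [] r' m' ∧ r' 10 = n := by
  have hch := h.isChildren_children hadj
  have hcard : Nat.card (Fin n) = n := Nat.card_fin n
  have hd : ∀ v, d v < n := fun v => (h.depth_lt_card v).trans_eq hcard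
  have hds : d s = 0 := (h.depth_eq_zero s).2 rfl
  have hsn := s.isLt
  have h2K : 1 ≤ 2 ^ (k + 1) := Nat.one_le_two_pow
  have hlen : ∀ i ≤ n, (dfsStack (children par adj) s i).length + i ≤ n := fun i hi =>
    (h.length_dfsStack_le hch (hi.trans_eq hcard.symm)).trans_eq hcard
  rw [show 72 * n + 17 = 3 + (3 + (3 + (3 + (1 + (1 + (1 + (72 * n + 2))))))) by ring]
  refine Does.seq (Does.set (x := M) (j := s) (y := s) E.r5 E.r4 (by norm_num) h1
    (by norm_num) h1 (by omega) ?_)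
  refine Does.seq (Does.set (x := M + 1) (j := s) (y := 0) (by simp [E.r5]) (by simp [E.r24])
    (by norm_num) (by simp [E.r30]) (by norm_num) (by simp [h1]) (by omega) ?_)
  refine Does.seq (Does.set (x := M + 2) (j := s) (y := 1) (by simp [E.r5]) (by simp [E.r25])
    (by norm_num) (by simp [E.r3]) (by norm_num) (by simp [h1]) (by omega) ?_)
  refine Does.seq (Does.set (x := M + 5) (j := 0) (y := s) (by simp [E.r5]) (by simp [E.r28])
    (by norm_num) (by simp [h1]) (by norm_num) (by simp [E.r30]) (by omega) ?_)
  refine Does.seq (Does.copy (Does.seq (Does.copy (Does.seq (Does.copy ?_)))))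
  refine Does.mono (T := 72 * n - 18 * 1 + 2)
    (Does.whileLt (I := fun p r' m' => ∃ i ≤ n,
      p = 72 * (n - i) - 18 * (dfsStack (children par adj) s i).length ∧
      SearchInv k M s par d (children par adj) inp i
        (dfsStack (children par adj) s i).reverse r' m' ∧ r' 10 = i) _ ?_ ?_ ?_)
      (by omega) fun _ _ h => h
  · refine ⟨0, Nat.zero_le _, rfl, ⟨?_, ?_, ?_, ?_, ?_, ?_, ?_, ?_, ?_, ?_, ?_⟩, ?_⟩
    · repeat (refine Env.update ?_ (by norm_num))
      exact E
    · simp [E.r3, dfsStack]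
    · intro a ha
      rw [Function.update_of_ne (by omega), Function.update_of_ne (by omega),
        Function.update_of_ne (by omega), Function.update_of_ne (by omega)]
      exact hm a ha
    · intro a ha
      rw [Function.update_of_ne (by omega), Function.update_of_ne (by omega),
        Function.update_of_ne (by omega), Function.update_of_ne (by omega)]
      exact hz a ha
    · intro j hj
      obtain rfl : j = 0 := by simpa [dfsStack] using hj
      simp [dfsStack]
    · intro v hv
      obtain rfl : v = s := by simpa [dfsStack] using hv
      constructor
      · rw [Function.update_of_ne (by omega), Function.update_of_ne (by omega),
          Function.update_of_ne (by omega), Function.update_self, h.par_root]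
      · rw [Function.update_of_ne (by omega), Function.update_of_ne (by omega),
          Function.update_self, hds]
      · rw [Function.update_of_ne (by omega), Function.update_self, hds, pow_zero,
          min_eq_left h2K]
    · simp
    · simp
    · simp
    · simp
    · exact ⟨s, by simp [hds, E.r30]⟩
    · simp [E.r30]
  · rintro p r m ⟨i, hi, rfl, hI, h10⟩ hlt
    rw [h10, hI.env.r0] at hlt
    have hlt' : i < Nat.card (Fin n) := by rwa [hcard]
    have hl1 := hlen (i + 1) hlt
    have hadjl := length_adj_le (par := par) hadj (dfsOrder (children par adj) s i)
    have hsucc := h.dfsStack_succ_eq hch hlt'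
    have heq := h.dfsStack_eq hch hlt'
    set v := dfsOrder (children par adj) s i with hv
    set L := dfsStack (children par adj) s (i + size par v) with hL
    rw [hsucc] at hl1
    simp only [heq, List.length_cons, List.length_append, List.reverse_cons] at hl1 hI ⊢
    refine ⟨31 + ((18 * (adj v).length + 2) + 1), by omega, Does.seq ?_⟩
    refine Does.mono (does_pop hI hlt hd hv.symm (by simp; omega) hinp.lt h10 hB hK) le_rfl ?_
    rintro r1 m1 ⟨hI1, g10, g11, g13, g14, g19, g20, g21⟩
    have hfil : L.reverse ++ (adj v).filter (· ≠ par v) =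
        (dfsStack (children par adj) s (i + 1)).reverse := by
      rw [hsucc, List.reverse_append, children, List.reverse_reverse]
    refine Does.seq (Does.mono (does_expand hI1 hlt hd (hinp.entry v) (hinp.le v)
      (fun u hu hne => (h.of_mem_adj hadj).1 ⟨hu, hne⟩) ?_ g11 g13 (g14.trans (hinp.next v))
      g19 g20 g21 hB) le_rfl ?_)
    · rw [hfil, List.length_reverse]
      have := hlen (i + 1) hlt
      omega
    · rintro r2 m2 ⟨hI2, f10⟩
      rw [hfil] at hI2
      have E2 := hI2.env
      refine Does.add (by rw [f10, g10, E2.r3]; omega) ?_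
      refine ⟨72 * (n - (i + 1)) - 18 * (dfsStack (children par adj) s (i + 1)).length, ?_,
        i + 1, hlt, rfl, hI2.of_reg (E2.update (by norm_num)) (by simp) (by simp), ?_⟩
      · rw [hsucc, List.length_append]
        omega
      · simp [f10, g10, E2.r3]
  · rintro p r m ⟨i, hi, rfl, hI, h10⟩ hge
    rw [h10, hI.env.r0] at hge
    obtain rfl : i = n := by omega
    have hnil := h.dfsStack_card hch
    rw [hcard] at hnil
    rw [hnil] at hI
    exact ⟨hI, h10⟩

end Correctness

end Firefighter

namespace Firefighter

open RAM Instr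

/-! ### Correctness of the dynamic program -/

section Correctness

variable {n k M B i : ℕ} {G : SimpleGraph (Fin n)} {s : Fin n} {par : Fin n → Fin n}
  {d : Fin n → ℕ} {ch : Fin n → List (Fin n)} {r m : ℕ → ℕ}

/-- The memory after the search: the records are complete except for the sizes, the search
order is known, and the list for the strategy has a vertex of the right depth at each of its
places. -/
structure IsSearched (k M : ℕ) (s : Fin n) (par : Fin n → Fin n) (d : Fin n → ℕ)
    (ch : Fin n → List (Fin n)) (m : ℕ → ℕ) : Prop where
  record : ∀ v, IsRecord k M par d m v
  order : ∀ j < n, m (M + 4 + 8 * j) = (dfsOrder ch s j).val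
  filler : ∀ v, ∃ x : Fin n, m (M + 8 * n + d v) = x ∧ d x = d v

theorem IsSearched.congr {m' : ℕ → ℕ} (hS : IsSearched k M s par d ch m)
    (h : ∀ e j, e ≤ 4 → e ≠ 3 → j < n → m' (M + e + 8 * j) = m (M + e + 8 * j))
    (hf : ∀ v, ∃ x : Fin n, m' (M + 8 * n + d v) = x ∧ d x = d v) :
    IsSearched k M s par d ch m' where
  record v := ⟨(h 0 v (by norm_num) (by norm_num) v.isLt).trans (hS.record v).par,
    (h 1 v (by norm_num) (by norm_num) v.isLt).trans (hS.record v).depth,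
    (h 2 v (by norm_num) (by norm_num) v.isLt).trans (hS.record v).weight⟩
  order j hj := (h 4 j (by norm_num) (by norm_num) hj).trans (hS.order j hj)
  filler := hf

theorem IsSearched.update_size (hS : IsSearched k M s par d ch m) (hd : ∀ v, d v < n)
    (p : Fin n) (y : ℕ) :
    IsSearched k M s par d ch (Function.update m (M + 3 + 8 * p) y) := by
  have hp := p.isLt
  refine hS.congr (fun e j he he' hj => Function.update_of_ne (by omega) _ _) fun v => ?_
  have := hd v
  rw [Function.update_of_ne (by omega)]
  exact hS.filler v

theorem IsSearched.update_table (hS : IsSearched k M s par d ch m) (hd : ∀ v, d v < n)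
    {a : ℕ} (ha : M + 9 * n ≤ a) (y : ℕ) :
    IsSearched k M s par d ch (Function.update m a y) := by
  refine hS.congr (fun e j he he' hj => Function.update_of_ne (by omega) _ _) fun v => ?_
  have := hd v
  rw [Function.update_of_ne (by omega)]
  exact hS.filler v

theorem IsSearched.update_filler (hS : IsSearched k M s par d ch m) (p : Fin n) :
    IsSearched k M s par d ch (Function.update m (M + 8 * n + d p) p) := by
  refine hS.congr (fun e j he he' hj => Function.update_of_ne (by omega) _ _) fun v => ?_
  by_cases hpv : d v = d p
  · exact ⟨p, by rw [hpv, Function.update_self], hpv.symm⟩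
  · rw [Function.update_of_ne (by omega)]
    exact hS.filler v

/-- When the loop has come down to `i`, the size field of `v` counts `v` and the subtrees of those
children that are at the place `i` or later.  All children are later than their parent, so the field
is final before it is added to that of the parent. -/
theorem does_sizes (h : IsRooting G s par d) (hch : IsChildren par d ch) (E : Env n k M r)
    (h10 : r 10 = n) (hS : IsSearched k M s par d ch m)
    (hone : ∀ v : Fin n, m (M + 3 + 8 * v) = 1)
    (hz : ∀ a, M + 9 * n ≤ a → m a = 0) (hB : M + 9 * n + 5 ≤ B) :
    Does B Prog.sizes (18 * n + 2) r m fun r' m' => Env n k M r' ∧ r' 18 = r 18 ∧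
      IsSearched k M s par d ch m' ∧ (∀ v : Fin n, m' (M + 3 + 8 * v) = size par v) ∧
      ∀ a, M + 9 * n ≤ a → m' a = 0 := by
  have hcard : Nat.card (Fin n) = n := Nat.card_fin n
  have hd : ∀ v, d v < n := fun v => (h.depth_lt_card v).trans_eq hcard
  have hn : 1 ≤ n := s.pos
  have hsize : ∀ (v : Fin n) {l : ℕ}, 1 ≤ l → (∀ j < n, dfsOrder ch s j = v → l ≤ j + 1) →
      size par v = 1 + ∑ j ∈ Finset.Ico l n,
        if par (dfsOrder ch s j) = v then size par (dfsOrder ch s j) else 0 := by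
    intro v l hl hl'
    obtain ⟨j, hj, rfl⟩ := h.exists_dfsOrder_eq hch v
    rw [h.size_dfsOrder hch hj hl (hl' j (hj.trans_eq hcard) rfl), hcard]
  have hle : ∀ (v : Fin n) {l : ℕ}, 1 ≤ l → 1 + ∑ j ∈ Finset.Ico l n,
        (if par (dfsOrder ch s j) = v then size par (dfsOrder ch s j) else 0) ≤ n := by
    intro v l hl
    refine le_trans ?_ ((Set.ncard_le_card {u | Anc par v u}).trans_eq hcard)
    rw [← size, hsize v le_rfl (fun _ _ _ => by omega)]
    exact Nat.add_le_add_left (Finset.sum_le_sum_of_subset (Finset.Ico_subset_Ico_left hl)) 1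
  refine Does.mono (Does.whileLt (I := fun p r' m' => ∃ i, 1 ≤ i ∧ i ≤ n ∧ p = 18 * i ∧
    Env n k M r' ∧ r' 18 = r 18 ∧ r' 10 = i ∧ IsSearched k M s par d ch m' ∧
    (∀ v : Fin n, m' (M + 3 + 8 * v) = 1 + ∑ j ∈ Finset.Ico i n,
      if par (dfsOrder ch s j) = v then size par (dfsOrder ch s j) else 0) ∧
    ∀ a, M + 9 * n ≤ a → m' a = 0) (18 * n) ?_ ?_ ?_) le_rfl fun _ _ h => h
  · exact ⟨n, hn, le_rfl, rfl, E, rfl, h10, hS, by simpa using hone, hz⟩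
  · rintro p r1 m ⟨i, hi1, hin, rfl, E, h18, h10, hS, hsum, hz⟩ hlt
    rw [E.r3, h10] at hlt
    obtain ⟨i, rfl⟩ : ∃ l, i = l + 1 := ⟨i - 1, by omega⟩
    have hne : dfsOrder ch s i ≠ s := h.dfsOrder_ne_root hch (by omega) (by omega)
    have hinj : ∀ j < n, dfsOrder ch s j = dfsOrder ch s i → j = i := by
      intro j hj he
      have := (h.dfsOrder_bijective hch).1 (a₁ := ⟨j, by omega⟩) (a₂ := ⟨i, by omega⟩) he
      simpa using this
    set v := dfsOrder ch s i with hv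
    have hvn := v.isLt
    have hpn := (par v).isLt
    have hsz := hsum v
    rw [← hsize v hi1 (fun j hj he => (congrArg (· + 1) (hinj j hj he)).ge)] at hsz
    have hsp := hle (par v) (l := i) (by omega)
    rw [Finset.sum_eq_sum_Ico_succ_bot (by omega), ← hv, if_pos rfl] at hsp
    refine ⟨1 + (3 + (3 + (3 + (3 + (1 + 3))))), by omega, ?_⟩
    refine Does.seq (Does.sub ?_)
    refine Does.seq (Does.get (x := M + 4) (j := i) (by simp [E.r5]) (by simp [E.r27])
      (by norm_num) (by simp [h10, E.r3]) (by omega) ?_)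
    rw [hS.order i (by omega)]
    refine Does.seq (Does.get (x := M) (j := v) (by simp [E.r5]) (by simp [E.r4])
      (by norm_num) (by simp [hv]) (by omega) ?_)
    rw [(hS.record v).par]
    refine Does.seq (Does.get (x := M + 3) (j := v) (by simp [E.r5]) (by simp [E.r26])
      (by norm_num) (by simp [hv]) (by omega) ?_)
    rw [hsz]
    refine Does.seq (Does.get (x := M + 3) (j := par v) (by simp [E.r5]) (by simp [E.r26])
      (by norm_num) (by simp) (by omega) ?_)
    rw [hsum (par v)]
    refine Does.seq (Does.add (by simp; omega) ?_)
    refine Does.set (x := M + 3) (j := par v) (y := 1 + ∑ j ∈ Finset.Ico i n,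
      if par (dfsOrder ch s j) = par v then size par (dfsOrder ch s j) else 0) (by simp [E.r5])
      (by simp [E.r26]) (by norm_num) ?_ (by norm_num) (by simp) (by omega) ?_
    · rw [Finset.sum_eq_sum_Ico_succ_bot (show i < n by omega), ← hv, if_pos rfl]
      simp; omega
    · refine ⟨18 * i, by omega, i, by omega, by omega, rfl, ?_, ?_, ?_,
        hS.update_size hd _ _, ?_, ?_⟩
      · repeat (refine Env.update ?_ (by norm_num))
        exact E
      · simp [h18]
      · simp [h10, E.r3]
      · intro u
        by_cases hu : u = par v
        · rw [hu, Function.update_self]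
        · have hu' : (u : ℕ) ≠ par v := fun h => hu (Fin.ext h)
          rw [Function.update_of_ne (by omega), hsum u,
            Finset.sum_eq_sum_Ico_succ_bot (show i < n by omega), ← hv,
            if_neg (fun h => hu h.symm), zero_add]
      · intro a ha
        rw [Function.update_of_ne (by omega)]
        exact hz a ha
  · rintro p r1 m ⟨i, hi1, hin, rfl, E, h18, h10, hS, hsum, hz⟩ hge
    rw [E.r3, h10] at hge
    obtain rfl : i = 1 := by omega
    refine ⟨E, h18, hS, fun v => ?_, hz⟩
    rw [hsum v, ← hsize v le_rfl (fun _ _ _ => by omega)]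

/-- The test in the table: the machine divides by `w` and looks at the parity. -/
theorem testBit_iff_parity {S e : ℕ} (hS : S < 2 ^ (k + 1)) :
    S / min (2 ^ e) (2 ^ (k + 1)) / 2 + S / min (2 ^ e) (2 ^ (k + 1)) / 2 <
      S / min (2 ^ e) (2 ^ (k + 1)) ↔ S.testBit e := by
  rw [Nat.testBit_eq_decide_div_mod_eq, decide_eq_true_eq]
  rcases le_total (2 ^ e) (2 ^ (k + 1)) with hle | hle
  · rw [min_eq_left hle]; omega
  · rw [min_eq_right hle, Nat.div_eq_of_lt hS, Nat.div_eq_of_lt (hS.trans_le hle)]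
    simp

/-- When the loop has come down to `q`, the recurrence holds for all entries from `q` on.  It refers
to later entries only.  The bound `F i S + i ≤ n`, which holds for the zeros of the untouched memory
as well, keeps the words short. -/
theorem does_table (h : IsRooting G s par d) (hch : IsChildren par d ch) (E : Env n k M r)
    (hS : IsSearched k M s par d ch m) (hsz : ∀ v : Fin n, m (M + 3 + 8 * v) = size par v)
    (hz : ∀ a, M + 9 * n ≤ a → m a = 0) (hB : M + 9 * n + 5 + 2 * n * 2 ^ (k + 1) ≤ B) :
    Does B Prog.table (38 * (n * 2 ^ (k + 1)) + 3) r m fun r' m' => Env n k M r' ∧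
      r' 18 = r 18 ∧ IsSearched k M s par d ch m' ∧
      (∀ v : Fin n, m' (M + 3 + 8 * v) = size par v) ∧
      IsTable par d ch s (2 ^ (k + 1)) fun i S => m' (M + 9 * n + (i * 2 ^ (k + 1) + S)) := by
  have hcard : Nat.card (Fin n) = n := Nat.card_fin n
  have hd : ∀ v, d v < n := fun v => (h.depth_lt_card v).trans_eq hcard
  have hn : 1 ≤ n := s.pos
  have hK0 : 0 < 2 ^ (k + 1) := by positivity
  obtain ⟨K, hK⟩ : ∃ K, K = 2 ^ (k + 1) := ⟨_, rfl⟩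
  rw [← hK] at hB hK0 ⊢
  have hnK : 2 * n * K = n * K + n * K := by ring
  rw [show 38 * (n * K) + 3 = 1 + (38 * (n * K) + 2) by ring]
  refine Does.seq (Does.mul (by rw [E.r0, E.r8, ← hK]; omega) ?_)
  rw [E.r0, E.r8, ← hK]
  refine Does.whileLt (I := fun p r' m' => ∃ q ≤ n * K, p = 38 * q ∧ Env n k M r' ∧
    r' 18 = r 18 ∧ r' 10 = q ∧ IsSearched k M s par d ch m' ∧
    (∀ v : Fin n, m' (M + 3 + 8 * v) = size par v) ∧
    (∀ i ≤ n, ∀ S < K, m' (M + 9 * n + (i * K + S)) + i ≤ n) ∧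
    ∀ i < n, ∀ S < K, q ≤ i * K + S → m' (M + 9 * n + (i * K + S)) =
      max (m' (M + 9 * n + ((i + 1) * K + S))) (if S.testBit (d (dfsOrder ch s i)) then
        size par (dfsOrder ch s i) + m' (M + 9 * n + ((i + size par (dfsOrder ch s i)) * K +
          (S - 2 ^ d (dfsOrder ch s i)))) else 0)) _ ?_ ?_ ?_
  · refine ⟨n * K, le_rfl, rfl, E.update (by norm_num), by simp, by simp, hS, hsz, ?_, ?_⟩
    · intro i hi S hS
      rw [hz _ (by omega)]; omega
    · intro i hi S hS hle
      have : (i + 1) * K ≤ n * K := Nat.mul_le_mul_right K hi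
      rw [add_mul, one_mul] at this
      omega
  · rintro p r1 m ⟨q, hq, rfl, E, h18, h10, hS, hsz, hbd, htab⟩ hlt
    rw [E.r30, h10] at hlt
    obtain ⟨q, rfl⟩ : ∃ q', q = q' + 1 := ⟨q - 1, by omega⟩
    obtain ⟨i, S, hSK, rfl⟩ : ∃ i S, S < K ∧ q = i * K + S :=
      ⟨q / K, q % K, Nat.mod_lt _ hK0, (Nat.div_add_mod' _ _).symm⟩
    have hin : i < n := by
      by_contra! hni
      have : n * K ≤ i * K := Nat.mul_le_mul_right K hni
      omega
    have hdiv : (i * K + S) / K = i := by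
      rw [mul_comm, Nat.mul_add_div hK0, Nat.div_eq_of_lt hSK, add_zero]
    have hsucc : (i + 1) * K = i * K + K := by ring
    have hsle : i + size par (dfsOrder ch s i) ≤ n :=
      (h.dfsOrder_add_size_le hch (hin.trans_eq hcard.symm)).trans_eq hcard
    have hspos := size_pos par (dfsOrder ch s i)
    set v := dfsOrder ch s i with hv
    have hvn := v.isLt
    have hsK : (i + size par v) * K = i * K + size par v * K := by ring
    have hs1 : K ≤ size par v * K := Nat.le_mul_of_pos_left K hspos
    have hs2 : (i + size par v) * K ≤ n * K := Nat.mul_le_mul_right K hsle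
    refine ⟨1 + (1 + (1 + (1 + (3 + (3 + (3 + (1 + (1 + (1 + (1 + (1 + (1 +
      ((1 + (1 + (1 + (1 + (1 + (1 + 2)))))) + 2 + 1))))))))))))), by omega, ?_⟩
    refine Does.seq (Does.sub (Does.seq (Does.div (Does.seq (Does.mul ?_ (Does.seq
      (Does.sub ?_)))))))
    · simp [h10, E.r3, E.r8, ← hK, hdiv]; omega
    refine Does.seq (Does.get (x := M + 4) (j := i) (by simp [E.r5]) (by simp [E.r27])
      (by norm_num) (by simp [h10, E.r3, E.r8, ← hK, hdiv]) (by omega) ?_)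
    rw [hS.order i hin, ← hv]
    refine Does.seq (Does.get (x := M + 3) (j := v) (by simp [E.r5]) (by simp [E.r26])
      (by norm_num) (by simp) (by omega) ?_)
    rw [hsz v]
    refine Does.seq (Does.get (x := M + 2) (j := v) (by simp [E.r5]) (by simp [E.r25])
      (by norm_num) (by simp) (by omega) ?_)
    rw [(hS.record v).weight, ← hK]
    have hpar := testBit_iff_parity (k := k) (e := d v) (hK ▸ hSK)
    rw [← hK] at hpar
    refine Does.seq (Does.add (by simp [h10, E.r7, E.r3]; omega) ?_)
    refine Does.seq (Does.add (by simp [h10, E.r7, E.r3, E.r8, ← hK]; omega)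
      (Does.seq (Does.load (Does.seq (Does.div (Does.seq (Does.div (Does.seq
        (Does.add ?_ ?_)))))))))
    · simp [h10, E.r3, E.r8, E.r31, ← hK, hdiv]
      have := Nat.div_le_self S (min (2 ^ d v) K)
      omega
    have hbest : m (M + 9 * n + (i * K + S) + K) = m (M + 9 * n + ((i + 1) * K + S)) := by
      rw [hsucc]; congr 1; ring
    have hw : S.testBit (d v) → min (2 ^ d v) K = 2 ^ d v := fun hb =>
      min_eq_left ((two_pow_le_of_testBit hb).trans hSK.le)
    obtain ⟨best, hbest'⟩ : ∃ b, b = max (m (M + 9 * n + ((i + 1) * K + S)))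
        (if S.testBit (d v) then size par v + m (M + 9 * n + ((i + size par v) * K +
          (S - 2 ^ d v))) else 0) := ⟨_, rfl⟩
    refine Does.seq (Does.mono (Q := fun r' m' => Env n k M r' ∧ r' 18 = r 18 ∧
      r' 10 = i * K + S ∧ r' 16 = M + 9 * n + (i * K + S) ∧ m' = m ∧ r' 17 = best)
      (Does.ifLt (fun hlt => ?_) (fun hge => ?_)) le_rfl ?_)
    · have hbit : S.testBit (d v) := by
        rw [← hpar]
        simpa [h10, E.r3, E.r8, E.r31, ← hK, hdiv] using hlt
      have h2d := two_pow_le_of_testBit hbit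
      have haddr : size par v * K + (M + 9 * n + (i * K + S)) - 2 ^ d v =
          M + 9 * n + ((i + size par v) * K + (S - 2 ^ d v)) := by
        rw [hsK]; omega
      have hcand := hbd (i + size par v) hsle (S - 2 ^ d v) (lt_of_le_of_lt (Nat.sub_le _ _) hSK)
      rw [if_pos hbit] at hbest'
      refine Does.seq (Does.mul ?_ (Does.seq (Does.add ?_ (Does.seq (Does.sub (Does.seq
        (Does.load (Does.seq (Does.add ?_ (Does.mono (Does.ifLt (T := 1) (fun hl => Does.copy ?_)
          (fun hl => Does.copy ?_)) le_rfl fun _ _ h => h))))))))))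
      · simp [E.r8, ← hK]; omega
      · simp [E.r8, ← hK, E.r7, h10, E.r3]; omega
      · simp [E.r8, ← hK, E.r7, h10, E.r3, hw hbit, haddr]; omega
      · simp [E.r8, ← hK, E.r7, h10, E.r3, hw hbit, haddr, hbest] at hl
        refine ⟨?_, ?_⟩
        · repeat (refine Env.update ?_ (by norm_num))
          exact E
        · simp [E.r8, ← hK, E.r7, h10, E.r3, hw hbit, haddr, h18]
          rw [hbest']; omega
      · simp [E.r8, ← hK, E.r7, h10, E.r3, hw hbit, haddr, hbest] at hl
        refine ⟨?_, ?_⟩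
        · repeat (refine Env.update ?_ (by norm_num))
          exact E
        · simp [E.r8, ← hK, E.r7, h10, E.r3, hw hbit, h18, hbest]
          rw [hbest']; omega
    · have hbit : ¬S.testBit (d v) := by
        rw [← hpar, not_lt]
        simpa [h10, E.r3, E.r8, E.r31, ← hK, hdiv] using hge
      refine Does.mono (Does.copy ?_) (by norm_num) fun _ _ h => h
      rw [if_neg hbit] at hbest'
      refine ⟨?_, ?_⟩
      · repeat (refine Env.update ?_ (by norm_num))
        exact E
      · simp [E.r8, ← hK, E.r7, h10, E.r3, h18, hbest, hbest']
    rintro r2 _ ⟨E2, g18, g10, g16, rfl, g17⟩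
    refine Does.store ?_
    rw [g16, g17]
    refine ⟨38 * (i * K + S), by omega, i * K + S, by omega, rfl, E2, g18, g10,
      hS.update_table hd (by omega) _, fun u => ?_, ?_, ?_⟩
    · have := u.isLt
      rw [Function.update_of_ne (by omega), hsz u]
    · intro i' hi' S' hS'
      by_cases he : i' * K + S' = i * K + S
      · have hdiv' : (i' * K + S') / K = i' := by
          rw [mul_comm, Nat.mul_add_div hK0, Nat.div_eq_of_lt hS', add_zero]
        obtain rfl : i' = i := by rw [← hdiv', he, hdiv]
        rw [he, Function.update_self, hbest']
        have h1 := hbd (i' + 1) hin S hSK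
        split_ifs with hb
        · have h2 := hbd (i' + size par v) hsle (S - 2 ^ d v) (lt_of_le_of_lt (Nat.sub_le _ _) hSK)
          omega
        · omega
      · rw [Function.update_of_ne (by omega)]
        exact hbd i' hi' S' hS'
    · intro i' hi' S' hS' hle
      have hspos' := size_pos par (dfsOrder ch s i')
      have hs1' : K ≤ size par (dfsOrder ch s i') * K := Nat.le_mul_of_pos_left K hspos'
      have e1 : (i' + 1) * K = i' * K + K := by ring
      have e2 : (i' + size par (dfsOrder ch s i')) * K =
        i' * K + size par (dfsOrder ch s i') * K := by ring
      rw [Function.update_of_ne (a := M + 9 * n + ((i' + 1) * K + S')) (by omega),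
        Function.update_of_ne (a := M + 9 * n + ((i' + size par (dfsOrder ch s i')) * K +
          (S' - 2 ^ d (dfsOrder ch s i')))) (by omega)]
      by_cases he : i' * K + S' = i * K + S
      · have hdiv' : (i' * K + S') / K = i' := by
          rw [mul_comm, Nat.mul_add_div hK0, Nat.div_eq_of_lt hS', add_zero]
        obtain rfl : i' = i := by rw [← hdiv', he, hdiv]
        obtain rfl : S' = S := by omega
        rw [Function.update_self]
        exact hbest'
      · rw [Function.update_of_ne (by omega)]
        exact htab i' hi' S' hS' (by omega)
  · rintro p r1 m ⟨q, hq, rfl, E, h18, h10, hS, hsz, hbd, htab⟩ hge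
    rw [E.r30, h10] at hge
    refine ⟨E, h18, hS, hsz, ⟨fun S hS => ?_, fun i hi S hS => ?_⟩⟩
    · rw [hcard]
      have := hbd n le_rfl S hS
      omega
    · rw [hcard] at hi
      exact htab i hi S hS (by omega)

end Correctness

end Firefighter

namespace Firefighter

open RAM Instr

section Correctness

variable {n k M B : ℕ} {G : SimpleGraph (Fin n)} {s : Fin n} {par : Fin n → Fin n}
  {d : Fin n → ℕ} {ch : Fin n → List (Fin n)} {r m : ℕ → ℕ}

/-- A chosen vertex is written to the place of its depth, which no earlier choice has, so that all
chosen vertices and vertices of the right depth at the other places remain in the list. -/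
theorem does_trace {F : ℕ → ℕ → ℕ} (h : IsRooting G s par d) (hch : IsChildren par d ch)
    (E : Env n k M r) (hS : IsSearched k M s par d ch m)
    (hsz : ∀ v : Fin n, m (M + 3 + 8 * v) = size par v)
    (hF : IsTable par d ch s (2 ^ (k + 1)) F)
    (hFm : ∀ i S, m (M + 9 * n + (i * 2 ^ (k + 1) + S)) = F i S)
    (hB : M + 9 * n + 5 + 2 * n * 2 ^ (k + 1) ≤ B) :
    Does B Prog.trace (25 * n + 4) r m fun r' m' => Env n k M r' ∧ r' 18 = r 18 ∧
      (∀ v, ∃ x : Fin n, m' (M + 8 * n + d v) = x ∧ d x = d v) ∧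
      (∀ i S, m' (M + 9 * n + (i * 2 ^ (k + 1) + S)) = F i S) ∧
      ∃ S A, IsTraced par d ch s F (2 ^ (k + 1) - 2) n S A ∧ S < 2 ^ (k + 1) ∧
        ∀ a ∈ A, m' (M + 8 * n + d a) = a.val := by
  have hcard : Nat.card (Fin n) = n := Nat.card_fin n
  have hd : ∀ v, d v < n := fun v => (h.depth_lt_card v).trans_eq hcard
  have hn : 1 ≤ n := s.pos
  have hK0 : 0 < 2 ^ (k + 1) := by positivity
  obtain ⟨K, hK⟩ : ∃ K, K = 2 ^ (k + 1) := ⟨_, rfl⟩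
  rw [← hK] at hF hFm hB hK0 ⊢
  have hnK : 2 * n * K = n * K + n * K := by ring
  rw [show 25 * n + 4 = 1 + (1 + (25 * n + 2)) by ring]
  refine Does.seq (Does.sub (Does.seq (Does.copy ?_)))
  refine Does.whileLt (I := fun p r' m' => ∃ i S A, p = 25 * (n - i) ∧ Env n k M r' ∧
    r' 18 = r 18 ∧ r' 10 = i ∧ r' 12 = S ∧ IsSearched k M s par d ch m' ∧
    (∀ v : Fin n, m' (M + 3 + 8 * v) = size par v) ∧
    (∀ i S, m' (M + 9 * n + (i * K + S)) = F i S) ∧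
    IsTraced par d ch s F (K - 2) i S A ∧ S < K ∧
    ∀ a ∈ A, m' (M + 8 * n + d a) = a.val) _ ?_ ?_ ?_
  · exact ⟨0, K - 2, ∅, rfl, (E.update (by norm_num)).update (by norm_num), by simp,
      by simp [E.r30], by simp [E.r8, E.r31, hK], hS, hsz, hFm, isTraced_zero _ _, by omega,
      by simp⟩
  · rintro p r1 m ⟨i, S, A, rfl, E, h18, h10, h12, hS, hsz, hFm, hT, hSK, hA⟩ hlt
    rw [h10, E.r0] at hlt
    have hlt' : i < Nat.card (Fin n) := hlt.trans_eq hcard.symm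
    have hsucc : (i + 1) * K = i * K + K := by ring
    have hle : (i + 1) * K ≤ n * K := Nat.mul_le_mul_right K hlt
    have e8 := E.r8
    rw [← hK] at e8
    have ha1 : i * K + S + (M + 9 * n) = M + 9 * n + (i * K + S) := add_comm _ _
    have ha2 : M + 9 * n + (i * K + S) + K = M + 9 * n + ((i + 1) * K + S) := by
      rw [hsucc]; ring
    refine ⟨1 + (1 + (1 + (1 + (1 + (1 + (16 + 2)))))), by omega, ?_⟩
    refine Does.seq (Does.mul ?_ (Does.seq (Does.add ?_ (Does.seq (Does.add ?_ (Does.seq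
      (Does.load (Does.seq (Does.add ?_ (Does.seq (Does.load ?_)))))))))))
    · simp [h10, e8]; omega
    · simp [h10, h12, e8]; omega
    · simp [h10, h12, e8, E.r7]; omega
    · simp [h10, h12, e8, E.r7]; omega
    refine Does.ifEq (fun he => ?_) (fun hne => ?_)
    · simp [h10, h12, e8, E.r7, ha1, ha2, hFm] at he
      refine Does.mono (Does.add (by simp [h10, E.r3]; omega) ?_) (by norm_num) fun _ _ h => h
      refine ⟨25 * (n - (i + 1)), by omega, i + 1, S, A, rfl, ?_, by simp [h18],
        by simp [h10, E.r3], by simp [h12], hS, hsz, hFm, hT.skip h hch hlt' he, hSK, hA⟩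
      repeat (refine Env.update ?_ (by norm_num))
      exact E
    · simp [h10, h12, e8, E.r7, ha1, ha2, hFm] at hne
      have hT' := hT.take hF h hch hlt' hSK hne
      have hbit := hF.testBit_of_ne hlt' hSK hne
      have hsle := h.dfsOrder_add_size_le hch hlt'
      have hspos := size_pos par (dfsOrder ch s i)
      rw [hcard] at hsle
      have hnot : ∀ a ∈ A, d a ≠ d (dfsOrder ch s i) := by
        intro a ha he
        have := hT.notMem a ha
        rw [he, hbit] at this
        exact absurd this (by simp)
      have hord := hS.order i hlt
      set v := dfsOrder ch s i with hv
      have hvn := v.isLt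
      have hdv := hd v
      have hw : min (2 ^ d v) K = 2 ^ d v :=
        min_eq_left ((two_pow_le_of_testBit hbit).trans hSK.le)
      rw [show 16 = 3 + (3 + (3 + (3 + (1 + (1 + (1 + 1)))))) by rfl]
      refine Does.seq (Does.get (x := M + 4) (j := i) (by simp [E.r5]) (by simp [E.r27])
        (by norm_num) (by simp [h10]) (by omega) ?_)
      rw [hord]
      refine Does.seq (Does.get (x := M + 3) (j := v) (by simp [E.r5]) (by simp [E.r26])
        (by norm_num) (by simp) (by omega) ?_)
      rw [hsz v]
      refine Does.seq (Does.get (x := M + 2) (j := v) (by simp [E.r5]) (by simp [E.r25])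
        (by norm_num) (by simp) (by omega) ?_)
      rw [(hS.record v).weight, ← hK, hw]
      refine Does.seq (Does.get (x := M + 1) (j := v) (by simp [E.r5]) (by simp [E.r24])
        (by norm_num) (by simp) (by omega) ?_)
      rw [(hS.record v).depth]
      refine Does.seq (Does.add (by simp [E.r6]; omega) (Does.seq (Does.store (Does.seq (Does.sub
        (Does.add (by simp [h10]; omega) ?_))))))
      have hstore : ∀ r' : ℕ → ℕ, r' 20 = d v → r' 6 = M + 8 * n → r' 13 = v →
          Function.update m (Function.update r' 20 (r' 20 + r' 6) 20)
            (Function.update r' 20 (r' 20 + r' 6) 13) =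
          Function.update m (M + 8 * n + d v) v := by
        intro r' h20 h6 h13
        rw [Function.update_self, Function.update_of_ne (by norm_num), h20, h6, h13, add_comm]
      rw [hstore _ (by simp) (by simp [E.r6]) (by simp)]
      refine ⟨25 * (n - (i + size par v)), by omega, i + size par v, S - 2 ^ d v, insert v A, rfl,
        ?_, by simp [h18], by simp [h10], by simp [h12], hS.update_filler v, fun u => ?_,
        fun i S => ?_, hT', lt_of_le_of_lt (Nat.sub_le _ _) hSK, ?_⟩
      · repeat (refine Env.update ?_ (by norm_num))
        exact E
      · have := u.isLt
        rw [Function.update_of_ne (by omega), hsz u]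
      · rw [Function.update_of_ne (by omega), hFm]
      · rintro a (rfl | ha)
        · rw [Function.update_self]
        · have := hnot a ha
          rw [Function.update_of_ne (by omega), hA a ha]
  · rintro p r1 m ⟨i, S, A, rfl, E, h18, h10, h12, hS, hsz, hFm, hT, hSK, hA⟩ hge
    rw [h10, E.r0] at hge
    obtain rfl : i = n := le_antisymm (hT.le_card.trans_eq hcard) hge
    exact ⟨E, h18, hS.filler, hFm, S, A, hT, hSK, hA⟩

/-! ### Correctness of the whole program -/

theorem does_finish (E : Env n k M r) (hB : M + 9 * n + 5 + 2 * n * 2 ^ (k + 1) ≤ B)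
    (hn : 1 ≤ n) : Does B Prog.finish 7 r m fun r' m' => m' = m ∧ r' 0 = min k (r 18) ∧
      r' 1 = M + 8 * n + 1 ∧ r' 2 = m (M + 9 * n + (2 ^ (k + 1) - 2)) := by
  have hK : 1 * 2 ^ (k + 1) ≤ n * 2 ^ (k + 1) := Nat.mul_le_mul_right _ hn
  have hK2 : 2 ≤ 2 ^ (k + 1) := by
    rw [pow_succ]; have := Nat.one_le_two_pow (n := k); omega
  obtain ⟨K, hK'⟩ : ∃ K, K = 2 ^ (k + 1) := ⟨_, rfl⟩
  have e8 := E.r8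
  rw [← hK'] at hB hK hK2 e8 ⊢
  have hnK : 2 * n * K = n * K + n * K := by ring
  have haddr : M + 9 * n + K - 2 = M + 9 * n + (K - 2) := by omega
  refine Does.seq (T₁ := 3) (T₂ := 4) (Does.mono (Q := fun r' m' => m' = m ∧
    r' 0 = min k (r 18) ∧ ∀ a, a ≠ 0 → r' a = r a) (Does.ifLt (T := 1) (fun hlt => Does.copy ?_)
      (fun hge => Does.copy ?_)) le_rfl ?_)
  · rw [E.r2] at hlt
    exact ⟨rfl, by simp [E.r2, hlt.le], fun a ha => by simp [ha]⟩
  · rw [E.r2] at hge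
    exact ⟨rfl, by simp [hge], fun a ha => by simp [ha]⟩
  · rintro r1 _ ⟨rfl, h0, hr⟩
    rw [show 4 = 1 + (1 + (1 + 1)) by rfl]
    refine Does.seq (Does.add ?_ (Does.seq (Does.sub (Does.seq (Does.load (Does.add ?_ ?_))))))
    · simp [hr, E.r7, e8]; omega
    · simp [hr, E.r6, E.r3]; omega
    · simp [hr, E.r6, E.r3, E.r7, E.r31, e8, h0, haddr]

theorem does_setup (h0 : r 0 = n) (h2 : r 2 = k) (h10 : r 10 = 0) (h30 : r 30 = 0)
    (hM : m n = M) (hn : 1 ≤ n) (hB : M + 9 * n + 5 + 2 * n * 2 ^ (k + 1) ≤ B) (h8 : 8 ≤ B) :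
    Does B Prog.setup (3 * k + 15) r m fun r' m' => m' = m ∧ Env n k M r' ∧ r' 1 = r 1 := by
  have hK : ∀ i ≤ k, 2 ^ (i + 1) ≤ n * 2 ^ (k + 1) := fun i hi =>
    (Nat.pow_le_pow_right (by norm_num) (by omega)).trans (Nat.le_mul_of_pos_left _ hn)
  have hkB := Nat.lt_two_pow_self (n := k + 1)
  have hKk := hK k le_rfl
  have hnK : 2 * n * 2 ^ (k + 1) = n * 2 ^ (k + 1) + n * 2 ^ (k + 1) := by ring
  rw [show 3 * k + 15 = 1 + (1 + (1 + (1 + (1 + (1 + (1 + (1 + (1 + (1 + (1 + (1 + (1 +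
    (3 * k + 2))))))))))))) by ring]
  refine Does.seq (Does.const (by omega) (Does.seq (Does.const (by omega) (Does.seq
    (Does.const (by omega) (Does.seq (Does.load ?_)))))))
  have e0 : ∀ r' : ℕ → ℕ, r' 0 = n → m (r' 0) = M := fun r' h => by rw [h, hM]
  rw [e0 _ (by simp [h0])]
  refine Does.seq (Does.mul (by simp [h0]; omega) (Does.seq (Does.add (by simp [h0]; omega)
    (Does.seq (Does.add (by simp [h0]; omega) (Does.seq (Does.add (by simp; omega) (Does.seq
    (Does.add (by simp; omega) (Does.seq (Does.add (by simp; omega) (Does.seq (Does.add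
    (by simp; omega) (Does.seq (Does.add (by simp; omega) (Does.seq (Does.const (by omega)
    ?_)))))))))))))))))
  refine Does.whileLt (I := fun p r' m' => ∃ i ≤ k, p = 3 * (k - i) ∧ m' = m ∧ r' 10 = i ∧
    r' 8 = 2 ^ (i + 1) ∧ r' 0 = n ∧ r' 1 = r 1 ∧ r' 2 = k ∧ r' 3 = 1 ∧ r' 4 = M ∧ r' 5 = 8 ∧
    r' 6 = M + 8 * n ∧ r' 7 = M + 9 * n ∧ r' 24 = M + 1 ∧ r' 25 = M + 2 ∧ r' 26 = M + 3 ∧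
    r' 27 = M + 4 ∧ r' 28 = M + 5 ∧ r' 30 = 0 ∧ r' 31 = 2) _ ?_ ?_ ?_
  · refine ⟨0, Nat.zero_le _, rfl, rfl, ?_⟩
    simp [h0, h2, h10, h30]
    omega
  · rintro p r1 _ ⟨i, hi, rfl, rfl, g10, g8, g0, g1, g2, g3, g4, g5, g6, g7, g24, g25, g26, g27,
      g28, g30, g31⟩ hlt
    rw [g10, g2] at hlt
    have hi1 := hK (i + 1) hlt
    have hpow : 2 ^ (i + 1 + 1) = 2 ^ (i + 1) + 2 ^ (i + 1) := by ring
    refine ⟨1 + 1, by omega, Does.seq (Does.add (by rw [g8]; omega) (Does.add ?_ ?_))⟩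
    · simp [g10, g3]; omega
    · refine ⟨3 * (k - (i + 1)), by omega, i + 1, hlt, rfl, rfl, ?_⟩
      simp [g10, g8, g0, g1, g2, g3, g4, g5, g6, g7, g24, g25, g26, g27, g28, g30, g31, hpow]
  · rintro p r1 _ ⟨i, hi, rfl, rfl, g10, g8, g0, g1, g2, g3, g4, g5, g6, g7, g24, g25, g26, g27,
      g28, g30, g31⟩ hge
    rw [g10, g2] at hge
    obtain rfl : i = k := le_antisymm hi hge
    exact ⟨rfl, ⟨g0, g2, g3, g4, g5, g6, g7, g8, g24, g25, g26, g27, g28, g30, g31⟩, g1⟩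

end Correctness

end Firefighter

namespace Firefighter

open RAM Instr

section Correctness

variable {n k M B : ℕ} {G : SimpleGraph (Fin n)} {s : Fin n} {par : Fin n → Fin n}
  {d : Fin n → ℕ} {adj : Fin n → List (Fin n)} {inp r m : ℕ → ℕ}

theorem SearchInv.isSearched {ch : Fin n → List (Fin n)}
    (hI : SearchInv k M s par d ch inp n [] r m) (h : IsRooting G s par d)
    (hch : IsChildren par d ch) :
    IsSearched k M s par d ch m ∧ (∀ v : Fin n, m (M + 3 + 8 * v) = 1) ∧ ∀ v, d v ≤ r 18 := by
  have key : ∀ v, ∃ j < n, dfsOrder ch s j = v := fun v => by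
    obtain ⟨j, hj, he⟩ := h.exists_dfsOrder_eq hch v
    exact ⟨j, hj.trans_eq (Nat.card_fin n), he⟩
  refine ⟨⟨fun v => hI.record v (Or.inr (key v)), hI.order, fun v => ?_⟩, fun v => ?_, fun v => ?_⟩
  · obtain ⟨j, hj, rfl⟩ := key v
    exact hI.filler j hj
  · obtain ⟨j, hj, rfl⟩ := key v
    exact hI.one j hj
  · obtain ⟨j, hj, rfl⟩ := key v
    exact hI.le_max j hj

/-- Correctness and running time of the program. -/
theorem does_main (h : IsRooting G s par d) (hadj : IsAdjacencyList G adj)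
    (hinp : IsInput adj M m) (hM : m n = M) (hz : ∀ a, M ≤ a → m a = 0)
    (h0 : r 0 = n) (h1 : r 1 = s) (h2 : r 2 = k) (h10 : r 10 = 0) (h30 : r 30 = 0)
    (hB : M + 9 * n + 5 + 2 * n * 2 ^ (k + 1) ≤ B) (h8 : 8 ≤ B) (hK : 2 ^ (k + 1) * 2 ≤ B) :
    Does B Prog.main (3 * k + 115 * n + 38 * (n * 2 ^ (k + 1)) + 48) r m fun r' m' =>
      ∃ p : List (Fin n), IsOptimal G s k (Strategy.ofList p) ∧ r' 0 = p.length ∧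
        (∀ (i : ℕ) (hi : i < p.length), m' (r' 1 + i) = (p[i] : ℕ)) ∧
        r' 2 = (saved G s (Strategy.ofList p)).ncard := by
  have hn : 1 ≤ n := s.pos
  have hcard : Nat.card (Fin n) = n := Nat.card_fin n
  have hch := h.isChildren_children hadj
  rw [show 3 * k + 115 * n + 38 * (n * 2 ^ (k + 1)) + 48 = (3 * k + 15) + ((72 * n + 17) +
    ((18 * n + 2) + ((38 * (n * 2 ^ (k + 1)) + 3) + ((25 * n + 4) + 7)))) by ring]
  refine Does.seq (Does.mono (does_setup h0 h2 h10 h30 hM hn hB h8) le_rfl ?_)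
  rintro r1 _ ⟨rfl, E1, g1⟩
  refine Does.seq (Does.mono (does_search h hadj hinp E1 (g1.trans h1) (fun _ _ => rfl)
    (fun a ha => hz a (by omega)) (by omega) hK) le_rfl ?_)
  rintro r2 m2 ⟨hI, g10⟩
  obtain ⟨hS, hone, hmax⟩ := hI.isSearched h hch
  obtain ⟨v₀, hv₀⟩ := hI.max_eq
  refine Does.seq (Does.mono (does_sizes h hch hI.env g10 hS hone hI.zero (by omega)) le_rfl ?_)
  rintro r3 m3 ⟨E3, g3, hS3, hsz3, hz3⟩
  refine Does.seq (Does.mono (does_table h hch E3 hS3 hsz3 hz3 hB) le_rfl ?_)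
  rintro r4 m4 ⟨E4, g4, hS4, hsz4, hF⟩
  refine Does.seq (Does.mono (does_trace h hch E4 hS4 hsz4 hF (fun _ _ => rfl) hB) le_rfl ?_)
  rintro r5 m5 ⟨E5, g5, hfill, hFm, S, A, hT, hSK, hA⟩
  refine Does.mono (does_finish E5 hB hn) le_rfl ?_
  rintro r6 m5 ⟨rfl, f0, f1, f2⟩
  rw [g5, g4, g3, ← hv₀] at f0
  -- The list in the memory, as a function of the depth, up to the largest depth `d v₀`.
  have hx : ∀ j, ∃ x : Fin n, j ≤ d v₀ → m5 (M + 8 * n + j) = x ∧ d x = j := by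
    intro j
    by_cases hj : j ≤ d v₀
    · obtain ⟨v, rfl⟩ := h.exists_depth_eq hj
      obtain ⟨x, hx⟩ := hfill v
      exact ⟨x, fun _ => hx⟩
    · exact ⟨s, fun hj' => absurd hj' hj⟩
  choose x hx using hx
  have hp : ∀ (i : ℕ) (hi : i < ((List.range (min k (d v₀))).map fun i => x (i + 1)).length),
      ((List.range (min k (d v₀))).map fun i => x (i + 1))[i] = x (i + 1) ∧ i + 1 ≤ d v₀ := by
    intro i hi
    simp only [List.length_map, List.length_range] at hi
    exact ⟨by simp, by omega⟩
  have hT' : IsTraced par d (children par adj) s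
      (fun i S => m4 (M + 9 * n + (i * 2 ^ (k + 1) + S))) (2 ^ (k + 1) - 2)
      (Nat.card (Fin n)) S A := by rw [hcard]; exact hT
  have hopt := hT'.isOptimal hF h hch hSK
    (p := (List.range (min k (d v₀))).map fun i => x (i + 1)) (by simp)
    (fun i hi => by rw [(hp i hi).1]; exact (hx _ (hp i hi).2).2) (fun a ha => ?_)
  · refine ⟨_, hopt.1, by simpa using f0, fun i hi => ?_, ?_⟩
    · rw [f1, (hp i hi).1, ← (hx _ (hp i hi).2).1]
      congr 1; ring
    · rw [hopt.2, f2]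
      simpa using hFm 0 (2 ^ (k + 1) - 2)
  · have hda := hT.mem a ha
    rw [testBit_full, decide_eq_true_eq] at hda
    have hmaxa := hmax a
    rw [← hv₀] at hmaxa
    have hxa := (hx (d a) hmaxa).1
    rw [hA a ha] at hxa
    rw [List.getElem?_eq_some_iff]
    refine ⟨by simp; omega, ?_⟩
    rw [(hp _ _).1, Nat.sub_add_cancel hda.1]
    exact (Fin.ext hxa).symm

/-! ### The input -/

/-- The `v`-th cell is the address where the list of the neighbours of `v` starts. -/
theorem inputArray_of_le (adj : Fin n → List (Fin n)) {v : ℕ} (hv : v ≤ n) :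
    (inputArray adj).getD v 0 = n + 1 + ((List.ofFn adj).take v).flatten.length := by
  rw [inputArray, List.getD_eq_getElem?_getD, List.getElem?_append_left (by simp; omega)]
  simp [Nat.lt_succ_iff.2 hv]

theorem inputArray_add (adj : Fin n → List (Fin n)) (j : ℕ) :
    (inputArray adj).getD (n + 1 + j) 0 =
      (((List.ofFn adj).flatten.map Fin.val)[j]?).getD 0 := by
  rw [inputArray, List.getD_eq_getElem?_getD, List.getElem?_append_right (by simp)]
  simp

theorem length_inputArray (adj : Fin n → List (Fin n)) :
    (inputArray adj).length = n + 1 + (List.ofFn adj).flatten.length := by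
  simp [inputArray, Function.comp_def]

theorem flatten_ofFn_split (adj : Fin n → List (Fin n)) (v : Fin n) :
    (List.ofFn adj).flatten = ((List.ofFn adj).take v).flatten ++
      (adj v ++ ((List.ofFn adj).drop (v + 1)).flatten) := by
  have hv : (v : ℕ) < (List.ofFn adj).length := by simp
  conv_lhs => rw [← List.take_append_drop v (List.ofFn adj), List.drop_eq_getElem_cons hv]
  simp

theorem isInput_inputArray (adj : Fin n → List (Fin n)) :
    IsInput adj (inputArray adj).length fun a => (inputArray adj).getD a 0 := by
  refine ⟨?_, fun v => ?_, fun v => ?_, fun v q hq => ?_⟩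
  · rw [length_inputArray]; omega
  · have hv : (v : ℕ) < (List.ofFn adj).length := by simp
    rw [inputArray_of_le adj v.isLt, inputArray_of_le adj v.isLt.le,
      List.take_succ_eq_append_getElem hv]
    simp [add_assoc]
  · have := congrArg List.length (flatten_ofFn_split adj v)
    rw [List.length_append, List.length_append] at this
    rw [inputArray_of_le adj v.isLt.le, length_inputArray]
    omega
  · rw [inputArray_of_le adj v.isLt.le, add_assoc (n + 1), inputArray_add,
      flatten_ofFn_split adj v, List.getElem?_map, List.getElem?_append_right (by omega),
      List.getElem?_append_left (by omega)]
    simp [hq]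

theorem inputArray_le (adj : Fin n → List (Fin n)) (a : ℕ) :
    (inputArray adj).getD a 0 ≤ (inputArray adj).length := by
  rcases Nat.lt_or_ge n a with ha | ha
  · obtain ⟨j, rfl⟩ := Nat.exists_eq_add_of_lt ha
    rw [show n + j + 1 = n + 1 + j by ring, inputArray_add, length_inputArray]
    cases hj : ((List.ofFn adj).flatten.map Fin.val)[j]? with
    | none => simp
    | some x =>
      obtain ⟨u, -, rfl⟩ := List.mem_map.1 (List.mem_of_getElem? hj)
      have := u.isLt
      simp only [Option.getD_some]; omega
  · rw [inputArray_of_le adj ha, length_inputArray]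
    have : ((List.ofFn adj).take a).flatten.length ≤ (List.ofFn adj).flatten.length :=
      ((List.take_sublist a (List.ofFn adj)).flatten).length_le
    omega

/-- A tree on `n` vertices has `n - 1` edges, and each of them appears twice in the array. -/
theorem length_inputArray_le (hG : G.IsTree) (hadj : IsAdjacencyList G adj) :
    (inputArray adj).length + 1 = 3 * n := by
  classical
  have h1 := hG.card_edgeFinset
  have h2 := G.sum_degrees_eq_twice_card_edges
  have h3 : ∀ v, (adj v).length = G.degree v := fun v => by
    rw [← List.toFinset_card_of_nodup (hadj v).1, ← G.card_neighborFinset_eq_degree]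
    congr 1
    ext u
    simp [(hadj v).2]
  have h4 : (List.ofFn adj).flatten.length = ∑ v, (adj v).length := by
    rw [List.length_flatten, List.map_ofFn, List.sum_ofFn]
    rfl
  rw [Fintype.card_fin] at h1
  rw [length_inputArray, h4, Finset.sum_congr rfl fun v _ => h3 v, h2]
  omega

end Correctness

theorem run_of_halted {P : Program} {x : Config} (h : Halted P x) (t : ℕ) : run P x t = x := by
  refine Function.iterate_fixed ?_ t
  rw [step, List.getElem?_eq_none h]

end Firefighter

/-! ### Time and word size -/

theorem mainTheorem4 :
    ∃ (P : RAM.Program) (C : ℕ),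
      ∀ (n k : ℕ) (G : SimpleGraph (Fin n)) (s : Fin n) (adj : Fin n → List (Fin n)),
        G.IsTree → Firefighter.IsAdjacencyList G adj →
          (∃ T ≤ C * (2 ^ k * max k 1 * n),
            RAM.Halted P (RAM.run P (Firefighter.inputConfig adj s k) T) ∧
            ∃ p : List (Fin n),
              Firefighter.IsOptimal G s k (Firefighter.Strategy.ofList p) ∧
              Firefighter.IsOutput (RAM.run P (Firefighter.inputConfig adj s k) T) p
                (Firefighter.saved G s (Firefighter.Strategy.ofList p)).ncard) ∧
          ∀ t : ℕ, RAM.WordsAtMost ((2 ^ k * (n + 1)) ^ C)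
            (RAM.run P (Firefighter.inputConfig adj s k) t) := by
  open Firefighter RAM in
  refine ⟨Prog.main.compile 0, 242, fun n k G s adj hG hadj => ?_⟩
  obtain ⟨par, d, h⟩ := exists_isRooting hG s
  have hn : 1 ≤ n := s.pos
  have h2k : 1 ≤ 2 ^ k := Nat.one_le_two_pow
  have hk : k ≤ 2 ^ k := Nat.lt_two_pow_self.le
  have hlen := length_inputArray_le hG hadj
  set M := (inputArray adj).length with hM
  -- All numbers are at most `16 * X`, and `X` is at least `2`, so that `X ^ 5` bounds them.
  set X := 2 ^ k * (n + 1) with hX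
  have hXn : n + 1 ≤ X := Nat.le_mul_of_pos_left _ h2k
  have hXk : 2 ^ k ≤ X := Nat.le_mul_of_pos_right _ (Nat.succ_pos n)
  have hXX : X = 2 ^ k * n + 2 ^ k := by rw [hX]; ring
  have hB : 16 * X ≤ X ^ 242 := by
    calc 16 * X = 2 ^ 4 * X := by norm_num
      _ ≤ X ^ 4 * X := Nat.mul_le_mul_right _ (Nat.pow_le_pow_left (by omega) 4)
      _ = X ^ 5 := by ring
      _ ≤ X ^ 242 := Nat.pow_le_pow_right (by omega) (by norm_num)
  have hnK : 2 * n * 2 ^ (k + 1) = 4 * (2 ^ k * n) := by ring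
  have hK : 2 ^ (k + 1) * 2 = 4 * 2 ^ k := by ring
  have hmain := does_main (B := X ^ 242) (k := k) (M := M) (r := (inputConfig adj s k).reg)
    (m := (inputConfig adj s k).mem) h hadj (isInput_inputArray adj)
    (by
      have := inputArray_of_le adj (le_refl n)
      rw [List.take_of_length_le (by simp), ← length_inputArray] at this
      exact this)
    (fun a ha => List.getD_eq_default _ _ ha) rfl rfl rfl rfl rfl (by omega) (by omega) (by omega)
  have hcode : CodeAt (Prog.main.compile 0) 0 (Prog.main.compile 0) := fun i _ => by simp
  have hwords : WordsAtMost (X ^ 242) (inputConfig adj s k) := by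
    refine ⟨fun r => ?_, fun a => ?_⟩
    · have := s.isLt
      simp only [inputConfig]
      split_ifs <;> omega
    · have := inputArray_le adj a
      simp only [inputConfig]
      omega
  obtain ⟨t, ht, hw, hpc, p, hopt, hp0, hp1, hp2⟩ := hmain _ 0 hcode hwords
  have hhalt : Halted (Prog.main.compile 0) (run (Prog.main.compile 0) (inputConfig adj s k) t) := by
    rw [Halted, Cmd.length_compile]
    exact (hpc.trans (zero_add _)).ge
  refine ⟨⟨t, ht.trans ?_, hhalt, p, hopt, hp0, hp1, hp2⟩, fun t' => ?_⟩
  -- The number `3 * k + 115 * n + 76 * (2 ^ k * n) + 48` of steps is at most `242` times the bound.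
  · have hY1 : 2 ^ k * n ≤ 2 ^ k * max k 1 * n :=
      Nat.mul_le_mul_right _ (Nat.le_mul_of_pos_right _ (by omega))
    have hY2 : k ≤ 2 ^ k * max k 1 * n := by
      calc k ≤ 1 * k * 1 := by omega
        _ ≤ 2 ^ k * max k 1 * n := by gcongr; exact le_max_left _ _
    have hY3 : n ≤ 2 ^ k * n := Nat.le_mul_of_pos_left _ h2k
    have hnK' : n * 2 ^ (k + 1) = 2 * (2 ^ k * n) := by ring
    omega
  · rcases le_total t' t with hle | hle
    · exact hw t' hle
    · obtain ⟨u, rfl⟩ := Nat.exists_eq_add_of_le hle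
      rw [run_add, run_of_halted hhalt]
      exact hw t le_rfl
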